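/- Let $M\subset\mathbb{R}^3$ be a convex surface of class $C^2$, that is, the whole boundary of a compact convex set with interior points, supposed to be a regular $C^2$ surface. Let $|XY|$ denote the intrinsic distance on $M$ (the infimum of the lengths of curves in $M$ from $X$ to $Y$), $T_XM$ the tangent plane at $X$ with origin at $X$, $\exp_X$ the exponential map at $X$, and $r_i$ the injectivity radius of $M$ (the infimum over $X\in M$ of the supremum of the $r>0$ such that $\exp_X$ maps the open disc of radius $r$ in $T_XM$ bijectively onto the open geodesic disc of radius $r$ about $X$ and all geodesics of length less than $r$ from $X$ are shortest arcs). Let $A^\circ B^\circ C^\circ D^\circ$ be a convex quadrilateral on $M$ with closed domain $Q\subset M$: $Q$ is closed; any two points of $Q$ are joined by a shortest arc of $M$, and all shortest arcs joining them lie in $Q$; and the boundary of $Q$ relative to $M$ is the simple closed curve formed by four shortest arcs $A^\circ B^\circ$, $B^\circ C^\circ$, $C^\circ D^\circ$, $D^\circ A^\circ$. Suppose that $Q$ lies in the closed geodesic disc with centre $A^\circ$ and radius $r_i$, and that the perimeter of the quadrilateral is smaller than $2r_i$. Let $w_{A^\circ},w_{B^\circ},w_{C^\circ},w_{D^\circ}>0$,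 and let $P_F$ be a weighted Fermat–Torricelli point, i.e. a point of $M$ at which $$f(X)=w_{A^\circ}|XA^\circ|+w_{B^\circ}|XB^\circ|+w_{C^\circ}|XC^\circ|+w_{D^\circ}|XD^\circ|$$ attains its minimum over $M$. Suppose that $P_F$ lies in the interior of $Q$ relative to $M$. The direct transformation (without reflections) with respect to $P_F$ is the following. For each $R\in\{A,B,C,D\}$ take the geodesic that starts at $P_F$ along a shortest arc from $P_F$ to $R^\circ$, let the point $R$ be the point of this geodesic at arc length $w_R:=w_{R^\circ}$ from $P_F$, and let $R'\in T_{P_F}M$ be the tangent vector of length $w_R$ in the initial direction of this geodesic. If $w_{A^\circ}=w_{C^\circ}$ and $w_{B^\circ}=w_{D^\circ}$, then the direct transformation exists, and for every such choice of $A,B,C,D$ and $A',B',C',D'$: each $R'$ lies in $T_{P_F}M$ with $|P_FR'|=w_R$ and $\exp_{P_F}(R')=R$, and moreover $|P_FR|=w_R$ whenever $w_R<r_i$; $A'B'C'D'$ is a nondegenerate parallelogram in $T_{P_F}M$; and its diagonals $A'C'$ and $B'D'$ bisect each other at $P_F$. -/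

import Mathlib

open scoped ENNReal Topology

/-- Euclidean three-space. -/
abbrev E3 : Type := EuclideanSpace ℝ (Fin 3)

/-- `M` is a regular surface of class `C²`: near each of its points it is the zero set of a
`C²` function whose differential does not vanish there. -/
def IsC2Surface (M : Set E3) : Prop :=
  ∀ x ∈ M, ∃ F : E3 → ℝ, ContDiffAt ℝ 2 F x ∧ fderiv ℝ F x ≠ 0 ∧
    ∀ᶠ y in 𝓝 x, (y ∈ M ↔ F y = 0)

/-- A `C²` convex surface: the whole boundary of a convex body (a compact convex set with
interior points), supposed to be a surface of class `C²`. -/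
def IsC2ConvexSurface (M : Set E3) : Prop :=
  (∃ K : Set E3, IsCompact K ∧ Convex ℝ K ∧ (interior K).Nonempty ∧ M = frontier K) ∧
    IsC2Surface M

/-- The tangent plane `T_x M`, as a linear subspace of three-space (its origin stands for `x`). -/
def tangentPlane (M : Set E3) (x : E3) : Submodule ℝ E3 :=
  Submodule.span ℝ (tangentConeAt ℝ M x)

/-- The intrinsic distance of `M`, with values in `[0, ∞]`: the infimum of the lengths of the
curves in `M` from `x` to `y`. -/
noncomputable def surfaceEDist (M : Set E3) (x y : E3) : ℝ≥0∞ :=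
  ⨅ (c : ℝ → E3) (_ : ContinuousOn c (Set.Icc 0 1) ∧ Set.MapsTo c (Set.Icc 0 1) M ∧
    c 0 = x ∧ c 1 = y), eVariationOn c (Set.Icc 0 1)

/-- The intrinsic distance as a real number (on a convex surface `surfaceEDist` is finite). -/
noncomputable def surfaceDist (M : Set E3) (x y : E3) : ℝ :=
  (surfaceEDist M x y).toReal

/-- A complete geodesic of `M`: a `C²` curve in `M` whose acceleration is everywhere
orthogonal to the tangent plane of `M`. -/
def IsGeodesic (M : Set E3) (γ : ℝ → E3) : Prop :=
  ContDiff ℝ 2 γ ∧ (∀ t, γ t ∈ M) ∧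
    ∀ t, ∀ v ∈ tangentPlane M (γ t), inner ℝ (deriv (deriv γ) t) v = 0

/-- `γ` is a geodesic parametrized by arc length whose restriction to `[0, |xy|]`
is a shortest arc from `x` to `y`. -/
def IsShortestGeodesic (M : Set E3) (x y : E3) (γ : ℝ → E3) : Prop :=
  IsGeodesic M γ ∧ (∀ t, ‖deriv γ t‖ = 1) ∧ γ 0 = x ∧ γ (surfaceDist M x y) = y

/-- The shortest arc from `x` to `y` carried by `γ`, as a set of points. -/
def arcSet (M : Set E3) (x y : E3) (γ : ℝ → E3) : Set E3 :=
  γ '' Set.Icc 0 (surfaceDist M x y)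

/-- `exp_x (v) = y`. -/
def ExpEq (M : Set E3) (x v y : E3) : Prop :=
  ∃ γ : ℝ → E3, IsGeodesic M γ ∧ γ 0 = x ∧ deriv γ 0 = v ∧ γ 1 = y

/-- `exp_x` maps the open disc of radius `r` of `T_x M` bijectively onto the open geodesic
disc of radius `r` and centre `x`, and the geodesics of length less than `r` from `x` are
shortest arcs. -/
def IsNormalRadius (M : Set E3) (x : E3) (r : ℝ) : Prop :=
  (∀ v y, ‖v‖ < r → ExpEq M x v y → surfaceDist M x y = ‖v‖) ∧
    ∀ y ∈ M, surfaceDist M x y < r → ∃! v : E3, ‖v‖ < r ∧ ExpEq M x v y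

/-- The injectivity radius of `M` at `x`. -/
noncomputable def injectivityRadiusAt (M : Set E3) (x : E3) : ℝ≥0∞ :=
  ⨆ (r : ℝ) (_ : IsNormalRadius M x r), ENNReal.ofReal r

/-- The injectivity radius of `M`. -/
noncomputable def injectivityRadius (M : Set E3) : ℝ≥0∞ :=
  ⨅ x ∈ M, injectivityRadiusAt M x

/-- The interior of a subset `Q` of `M`, relative to `M`. -/
def surfaceInterior (M Q : Set E3) : Set E3 :=
  {x | x ∈ Q ∧ Q ∈ 𝓝[M] x}

/-- `Q` is convex in `M`: any two of its points are joined by a shortest arc, and the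
shortest arcs that join them lie in `Q`. -/
def IsSurfaceConvex (M Q : Set E3) : Prop :=
  ∀ x ∈ Q, ∀ y ∈ Q, (∃ γ, IsShortestGeodesic M x y γ) ∧
    ∀ γ, IsShortestGeodesic M x y γ → arcSet M x y γ ⊆ Q

/-- `Q` is the closed domain of a convex quadrilateral of `M` with consecutive vertices
`V 0, V 1, V 2, V 3`: it is closed and convex, and its boundary relative to `M` is the simple
closed curve formed by four shortest arcs, the sides `V i V (i + 1)` (indices mod 4). -/
def IsConvexQuadrilateral (M Q : Set E3) (V : Fin 4 → E3) : Prop :=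
  Q ⊆ M ∧ IsClosed Q ∧ IsSurfaceConvex M Q ∧ Function.Injective V ∧
    ∃ σ : Fin 4 → ℝ → E3,
      (∀ i, IsShortestGeodesic M (V i) (V (i + 1)) (σ i)) ∧
      (∀ i, arcSet M (V i) (V (i + 1)) (σ i) ∩
        arcSet M (V (i + 1)) (V (i + 1 + 1)) (σ (i + 1)) = {V (i + 1)}) ∧
      (∀ i, Disjoint (arcSet M (V i) (V (i + 1)) (σ i))
        (arcSet M (V (i + 2)) (V (i + 2 + 1)) (σ (i + 2)))) ∧
      Q \ surfaceInterior M Q = ⋃ i, arcSet M (V i) (V (i + 1)) (σ i)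

/-- `P` is a weighted Fermat-Torricelli point on `M` of the points `V i` with weights `w i`. -/
def IsFermatTorricelli (M : Set E3) (V : Fin 4 → E3) (w : Fin 4 → ℝ) (P : E3) : Prop :=
  P ∈ M ∧ ∀ X ∈ M, ∑ i, w i * surfaceDist M P (V i) ≤ ∑ i, w i * surfaceDist M X (V i)

/-- The direct transformation with respect to `P` (no vertex is reflected in `P`):
`R i` is the point at arc length `w i` from `P` on the geodesic that starts at `P` along a
shortest arc to `V i`, and `R' i` is the tangent vector at `P` of length `w i`
in the direction of this geodesic. -/
def IsDirectTransform (M : Set E3) (P : E3) (V : Fin 4 → E3) (w : Fin 4 → ℝ)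
    (R R' : Fin 4 → E3) : Prop :=
  ∀ i, ∃ γ : ℝ → E3, IsShortestGeodesic M P (V i) γ ∧ R i = γ (w i) ∧ R' i = w i • deriv γ 0

/-- `a b c d` is a (nondegenerate) parallelogram. -/
def IsParallelogram (a b c d : E3) : Prop :=
  b - a = c - d ∧ AffineIndependent ℝ ![a, b, d]

open Set Filter

/-! ### The intrinsic distance -/

/-! Let `u i` be the unit initial direction at `P` of a shortest arc to `V i`. At a minimum of `f`
the first variation gives `∑ w i • u i = 0` (`sum_smul_deriv_eq_zero`), that is, `a • (u 0 + u 2) +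
b • (u 1 + u 3) = 0` with `a = w 0`, `b = w 1`. The theorem amounts to `u 2 = -u 0` and `u 3 = -u
1`. Balance alone does not give this: the bisector of `u 0, u 2` may be opposite to that of `u 1, u
3`. In that case, however, the pairs `{u 0, u 2}` and `{u 1, u 3}` do not separate each other on the
unit circle, so it suffices that the directions follow the cyclic order of the vertices.

The cyclic order comes from the map sending a boundary point of `Q` to its direction at `P`. It is
continuous and injective (`IsSurfaceConvex.exists_direction_map`), so the two halves of the boundary
between `V 1` and `V 3` go to connected subsets of the circle that meet only in `u 1` and `u 3`. If
`u 1 + u 3 ≠ 0`, both subsets would have to contain the normalized midpoint of `u 1` and `u 3`, a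
contradiction (`add_eq_zero_of_balanced`).

Injectivity holds because points strictly between an interior point and a point of `Q` are interior
(`IsSurfaceConvex.apply_mem_surfaceInterior`). Continuity rests on uniqueness of short shortest arcs
and on a Gronwall estimate for geodesics. Both need boundary points to be closer to `P` than the
injectivity radius; comparing `f P` with the values of `f` at the vertices bounds these distances by
half of the perimeter (`two_mul_surfaceDist_le_perimeter`). -/

theorem surfaceEDist_le_eVariationOn {M : Set E3} {x y : E3} {c : ℝ → E3}
    (h1 : ContinuousOn c (Icc 0 1)) (h2 : MapsTo c (Icc 0 1) M) (h3 : c 0 = x) (h4 : c 1 = y) :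
    surfaceEDist M x y ≤ eVariationOn c (Icc 0 1) :=
  iInf₂_le c ⟨h1, h2, h3, h4⟩

/-- Affine reparametrization to `[0, 1]`. The one length bound that serves geodesics, constant
curves and segments lifted from a parameter plane. -/
theorem surfaceEDist_le_of_lipschitzOnWith {M : Set E3} {γ : ℝ → E3} {C : NNReal} {a b : ℝ}
    (hab : a ≤ b) (hγ : LipschitzOnWith C γ (Icc a b)) (hM : MapsTo γ (Icc a b) M) :
    surfaceEDist M (γ a) (γ b) ≤ C * ENNReal.ofReal (b - a) := by
  set φ : ℝ → ℝ := fun t => a + t * (b - a) with hφ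
  have hmap : MapsTo φ (Icc 0 1) (Icc a b) := by
    rintro t ⟨h0, h1⟩
    constructor
    · have := mul_nonneg h0 (sub_nonneg.2 hab)
      simp only [hφ]; linarith
    · have := mul_le_mul_of_nonneg_right h1 (sub_nonneg.2 hab)
      simp only [hφ]; linarith
  have hmono : MonotoneOn φ (Icc 0 1) := by
    intro s _ t _ hst
    have := mul_le_mul_of_nonneg_right hst (sub_nonneg.2 hab)
    simp only [hφ]; linarith
  have hvar : eVariationOn φ (Icc 0 1) = ENNReal.ofReal (b - a) := by
    have h := hmono.eVariationOn_eq (a := 0) (b := 1) (by simp) (by simp)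
    rw [inter_self] at h
    rw [h]; congr 1; simp only [hφ]; ring
  have hcont : Continuous φ := by fun_prop
  refine (surfaceEDist_le_eVariationOn (c := γ ∘ φ)
    (hγ.continuousOn.comp hcont.continuousOn hmap) (hM.comp hmap) ?_ ?_).trans ?_
  · simp [hφ]
  · simp [hφ]
  · rw [← hvar]
    exact hγ.comp_eVariationOn_le hmap

theorem surfaceEDist_comm_le (M : Set E3) (x y : E3) : surfaceEDist M x y ≤ surfaceEDist M y x := by
  refine le_iInf₂ fun c hc => ?_
  obtain ⟨h1, h2, rfl, rfl⟩ := hc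
  have hmap : MapsTo (fun t : ℝ => 1 - t) (Icc 0 1) (Icc 0 1) := by
    rintro t ⟨h0, h1⟩
    constructor <;> linarith
  have hanti : AntitoneOn (fun t : ℝ => 1 - t) (Icc 0 1) := by
    intro s _ t _ hst
    simp only; linarith
  have hcont : Continuous (fun t : ℝ => 1 - t) := by fun_prop
  refine (surfaceEDist_le_eVariationOn (c := c ∘ fun t => 1 - t)
    (h1.comp hcont.continuousOn hmap) (h2.comp hmap) ?_ ?_).trans ?_
  · simp
  · simp
  · exact eVariationOn.comp_le_of_antitoneOn c _ hanti hmap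

theorem surfaceEDist_comm (M : Set E3) (x y : E3) : surfaceEDist M x y = surfaceEDist M y x :=
  le_antisymm (surfaceEDist_comm_le M x y) (surfaceEDist_comm_le M y x)

theorem surfaceDist_comm (M : Set E3) (x y : E3) : surfaceDist M x y = surfaceDist M y x := by
  rw [surfaceDist, surfaceEDist_comm, surfaceDist]

theorem surfaceDist_nonneg (M : Set E3) (x y : E3) : 0 ≤ surfaceDist M x y :=
  ENNReal.toReal_nonneg

theorem surfaceEDist_triangle (M : Set E3) (x y z : E3) :
    surfaceEDist M x z ≤ surfaceEDist M x y + surfaceEDist M y z := by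
  simp only [surfaceEDist]
  rw [ENNReal.iInf₂_add]
  refine le_iInf₂ fun c hc => ?_
  rw [ENNReal.add_iInf₂]
  refine le_iInf₂ fun d hd => ?_
  obtain ⟨c1, c2, c3, c4⟩ := hc
  obtain ⟨d1, d2, d3, d4⟩ := hd
  set e : ℝ → E3 := fun t => if t ≤ 1 / 2 then c (2 * t) else d (2 * t - 1) with he
  have e1 : EqOn e (c ∘ fun t => 2 * t) (Icc 0 (1 / 2)) := by
    intro t ht
    simp only [he, if_pos ht.2, Function.comp]
  have e2 : EqOn e (d ∘ fun t => 2 * t - 1) (Icc (1 / 2) 1) := by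
    intro t ht
    rcases eq_or_lt_of_le ht.1 with h | h
    · simp only [he, ← h, le_refl, if_true, Function.comp]
      norm_num [c4, d3]
    · simp only [he, if_neg (not_le.2 h), Function.comp]
  have m1 : MapsTo (fun t : ℝ => 2 * t) (Icc 0 (1 / 2)) (Icc 0 1) := by
    rintro t ⟨h0, h1⟩; constructor <;> linarith
  have m2 : MapsTo (fun t : ℝ => 2 * t - 1) (Icc (1 / 2) 1) (Icc 0 1) := by
    rintro t ⟨h0, h1⟩; constructor <;> linarith
  have k1 : ContinuousOn e (Icc 0 (1 / 2)) :=
    (c1.comp (by fun_prop) m1).congr e1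
  have k2 : ContinuousOn e (Icc (1 / 2) 1) :=
    (d1.comp (by fun_prop) m2).congr e2
  have hU : Icc (0 : ℝ) 1 = Icc 0 (1 / 2) ∪ Icc (1 / 2) 1 :=
    (Icc_union_Icc_eq_Icc (by norm_num) (by norm_num)).symm
  have hvar := eVariationOn.Icc_add_Icc e (s := univ) (a := 0) (b := 1 / 2) (c := 1)
    (by norm_num) (by norm_num) (mem_univ _)
  simp only [univ_inter] at hvar
  refine (surfaceEDist_le_eVariationOn (c := e) ?_ ?_ ?_ ?_).trans ?_
  · rw [hU]
    exact k1.union_of_isClosed k2 isClosed_Icc isClosed_Icc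
  · rw [hU]
    rintro t (ht | ht)
    · rw [e1 ht]; exact c2 (m1 ht)
    · rw [e2 ht]; exact d2 (m2 ht)
  · rw [e1 (by norm_num)]; simpa using c3
  · rw [e2 (by norm_num)]; norm_num [d4]
  · rw [← hvar, eVariationOn.congr e1, eVariationOn.congr e2]
    refine add_le_add ?_ ?_
    · refine eVariationOn.comp_le_of_monotoneOn c _ (fun s _ t _ hst => ?_) m1
      linarith
    · refine eVariationOn.comp_le_of_monotoneOn d _ (fun s _ t _ hst => ?_) m2
      linarith

/-- Finiteness has to be carried along because `toReal` sends `⊤` to `0`. -/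
theorem surfaceDist_triangle {M : Set E3} {x y z : E3} (h1 : surfaceEDist M x y ≠ ⊤)
    (h2 : surfaceEDist M y z ≠ ⊤) :
    surfaceDist M x z ≤ surfaceDist M x y + surfaceDist M y z := by
  rw [surfaceDist, surfaceDist, surfaceDist, ← ENNReal.toReal_add h1 h2]
  exact ENNReal.toReal_mono (ENNReal.add_ne_top.2 ⟨h1, h2⟩) (surfaceEDist_triangle M x y z)

theorem surfaceEDist_ne_top_trans {M : Set E3} {x y z : E3} (h1 : surfaceEDist M x y ≠ ⊤)
    (h2 : surfaceEDist M y z ≠ ⊤) : surfaceEDist M x z ≠ ⊤ :=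
  ne_top_of_le_ne_top (ENNReal.add_ne_top.2 ⟨h1, h2⟩) (surfaceEDist_triangle M x y z)

/-! ### Elementary operations on geodesics -/

namespace IsGeodesic

variable {M : Set E3} {γ : ℝ → E3}

theorem differentiable (h : IsGeodesic M γ) : Differentiable ℝ γ :=
  h.1.differentiable (by norm_num)

theorem contDiff_deriv (h : IsGeodesic M γ) : ContDiff ℝ 1 (deriv γ) :=
  ((contDiff_succ_iff_deriv (n := 1)).1 (by rw [one_add_one_eq_two]; exact h.1)).2.2

theorem differentiable_deriv (h : IsGeodesic M γ) : Differentiable ℝ (deriv γ) :=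
  h.contDiff_deriv.differentiable (by norm_num)

theorem hasDerivAt (h : IsGeodesic M γ) (t : ℝ) : HasDerivAt γ (deriv γ t) t :=
  (h.differentiable t).hasDerivAt

theorem hasDerivAt_deriv (h : IsGeodesic M γ) (t : ℝ) :
    HasDerivAt (deriv γ) (deriv (deriv γ) t) t :=
  (h.differentiable_deriv t).hasDerivAt

theorem hasDerivAt_affine (h : IsGeodesic M γ) (a b t : ℝ) :
    HasDerivAt (fun t => γ (a * t + b)) (a • deriv γ (a * t + b)) t := by
  have h1 : HasDerivAt (fun t : ℝ => a * t + b) a t := by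
    simpa using ((hasDerivAt_id t).const_mul a).add_const b
  exact (h.hasDerivAt _).scomp t h1

theorem deriv_affine (h : IsGeodesic M γ) (a b : ℝ) :
    deriv (fun t => γ (a * t + b)) = fun t => a • deriv γ (a * t + b) :=
  funext fun t => (h.hasDerivAt_affine a b t).deriv

/-- Affine reparametrizations of geodesics are geodesics. -/
theorem affine (h : IsGeodesic M γ) (a b : ℝ) : IsGeodesic M (fun t => γ (a * t + b)) := by
  refine ⟨h.1.comp (by fun_prop), fun t => h.2.1 _, fun t v hv => ?_⟩
  have h1 : HasDerivAt (fun t : ℝ => a * t + b) a t := by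
    simpa using ((hasDerivAt_id t).const_mul a).add_const b
  have h2 : HasDerivAt (fun t => a • deriv γ (a * t + b))
      (a • a • deriv (deriv γ) (a * t + b)) t :=
    ((h.hasDerivAt_deriv _).scomp t h1).const_smul a
  rw [h.deriv_affine, h2.deriv, inner_smul_left, inner_smul_left, h.2.2 _ v hv]
  simp

theorem lipschitzWith (h : IsGeodesic M γ) (h1 : ∀ t, ‖deriv γ t‖ = 1) : LipschitzWith 1 γ :=
  lipschitzWith_of_nnnorm_deriv_le h.differentiable fun t => by
    rw [← NNReal.coe_le_coe]; simp [h1 t]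

theorem surfaceEDist_le (h : IsGeodesic M γ) (h1 : ∀ t, ‖deriv γ t‖ = 1) {a b : ℝ} (hab : a ≤ b) :
    surfaceEDist M (γ a) (γ b) ≤ ENNReal.ofReal (b - a) := by
  simpa using surfaceEDist_le_of_lipschitzOnWith hab ((h.lipschitzWith h1).lipschitzOnWith)
    (fun t _ => h.2.1 t)

theorem surfaceEDist_ne_top (h : IsGeodesic M γ) (h1 : ∀ t, ‖deriv γ t‖ = 1) (a b : ℝ) :
    surfaceEDist M (γ a) (γ b) ≠ ⊤ := by
  rcases le_total a b with hab | hab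
  · exact ne_top_of_le_ne_top ENNReal.ofReal_ne_top (h.surfaceEDist_le h1 hab)
  · rw [surfaceEDist_comm]
    exact ne_top_of_le_ne_top ENNReal.ofReal_ne_top (h.surfaceEDist_le h1 hab)

theorem surfaceDist_le (h : IsGeodesic M γ) (h1 : ∀ t, ‖deriv γ t‖ = 1) {a b : ℝ} (hab : a ≤ b) :
    surfaceDist M (γ a) (γ b) ≤ b - a :=
  ENNReal.toReal_le_of_le_ofReal (sub_nonneg.2 hab) (h.surfaceEDist_le h1 hab)

end IsGeodesic

namespace IsShortestGeodesic

variable {M : Set E3} {x y : E3} {γ : ℝ → E3}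

theorem surfaceEDist_ne_top (h : IsShortestGeodesic M x y γ) : surfaceEDist M x y ≠ ⊤ := by
  have := h.1.surfaceEDist_ne_top h.2.1 0 (surfaceDist M x y)
  rwa [h.2.2.1, h.2.2.2] at this

theorem mem_left (h : IsShortestGeodesic M x y γ) : x ∈ M := h.2.2.1 ▸ h.1.2.1 0

theorem mem_right (h : IsShortestGeodesic M x y γ) : y ∈ M := h.2.2.2 ▸ h.1.2.1 _

theorem dist_pos (h : IsShortestGeodesic M x y γ) (hxy : x ≠ y) : 0 < surfaceDist M x y := by
  refine (surfaceDist_nonneg M x y).lt_of_ne fun h0 => hxy ?_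
  rw [← h.2.2.1, ← h.2.2.2, ← h0]

/-- Subarcs of shortest arcs are shortest. -/
theorem surfaceDist_eq (h : IsShortestGeodesic M x y γ) {a b : ℝ} (ha : 0 ≤ a) (hab : a ≤ b)
    (hb : b ≤ surfaceDist M x y) : surfaceDist M (γ a) (γ b) = b - a := by
  -- A shorter connection of `γ a` and `γ b`, completed by the two remaining pieces, would beat the
  -- distance from `x` to `y`.
  refine le_antisymm (h.1.surfaceDist_le h.2.1 hab) ?_
  have h1 := h.1.surfaceDist_le h.2.1 ha
  have h2 := h.1.surfaceDist_le h.2.1 hb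
  rw [h.2.2.1] at h1
  rw [h.2.2.2] at h2
  have n1 := h.1.surfaceEDist_ne_top h.2.1 0 a
  have n2 := h.1.surfaceEDist_ne_top h.2.1 a b
  have n3 := h.1.surfaceEDist_ne_top h.2.1 b (surfaceDist M x y)
  rw [h.2.2.1] at n1
  rw [h.2.2.2] at n3
  have t1 := surfaceDist_triangle n1 n2
  have t2 := surfaceDist_triangle (surfaceEDist_ne_top_trans n1 n2) n3
  linarith

theorem surfaceDist_left (h : IsShortestGeodesic M x y γ) {a : ℝ} (ha : 0 ≤ a)
    (hb : a ≤ surfaceDist M x y) : surfaceDist M x (γ a) = a := by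
  simpa [h.2.2.1] using h.surfaceDist_eq le_rfl ha hb

theorem surfaceDist_right (h : IsShortestGeodesic M x y γ) {a : ℝ} (ha : 0 ≤ a)
    (hb : a ≤ surfaceDist M x y) : surfaceDist M (γ a) y = surfaceDist M x y - a := by
  simpa [h.2.2.2] using h.surfaceDist_eq ha hb le_rfl

/-- The initial part of a shortest arc. -/
theorem initial (h : IsShortestGeodesic M x y γ) {a : ℝ} (ha : 0 ≤ a)
    (hb : a ≤ surfaceDist M x y) : IsShortestGeodesic M x (γ a) γ :=
  ⟨h.1, h.2.1, h.2.2.1, by rw [h.surfaceDist_left ha hb]⟩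

theorem norm_deriv_affine {γ : ℝ → E3} (h : IsGeodesic M γ) (h1 : ∀ t, ‖deriv γ t‖ = 1)
    {a : ℝ} (ha : |a| = 1) (b t : ℝ) : ‖deriv (fun t => γ (a * t + b)) t‖ = 1 := by
  rw [h.deriv_affine, norm_smul, h1, Real.norm_eq_abs, ha, one_mul]

/-- A shortest arc, run backwards. -/
theorem reverse (h : IsShortestGeodesic M x y γ) :
    IsShortestGeodesic M y x (fun t => γ (-1 * t + surfaceDist M x y)) := by
  refine ⟨h.1.affine _ _, norm_deriv_affine h.1 h.2.1 (by simp) _, ?_, ?_⟩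
  · simpa using h.2.2.2
  · rw [surfaceDist_comm]; simpa using h.2.2.1

theorem mem_arcSet_left (h : IsShortestGeodesic M x y γ) : x ∈ arcSet M x y γ :=
  ⟨0, ⟨le_rfl, surfaceDist_nonneg M x y⟩, h.2.2.1⟩

theorem mem_arcSet_right (h : IsShortestGeodesic M x y γ) : y ∈ arcSet M x y γ :=
  ⟨_, ⟨surfaceDist_nonneg M x y, le_rfl⟩, h.2.2.2⟩

theorem isPreconnected_arcSet (h : IsShortestGeodesic M x y γ) : IsPreconnected (arcSet M x y γ) :=
  isPreconnected_Icc.image _ h.1.1.continuous.continuousOn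

/-- Distances to the end points add up along a shortest arc. -/
theorem surfaceDist_add (h : IsShortestGeodesic M x y γ) {z : E3} (hz : z ∈ arcSet M x y γ) :
    surfaceDist M x z + surfaceDist M z y = surfaceDist M x y := by
  obtain ⟨s, hs, rfl⟩ := hz
  rw [h.surfaceDist_left hs.1 hs.2, h.surfaceDist_right hs.1 hs.2]
  ring

end IsShortestGeodesic

/-! ### Local structure of regular surfaces -/

/-- `F` is a regular `C²` equation of `M` near `x`. -/
def IsLocalEquation (M : Set E3) (F : E3 → ℝ) (x : E3) : Prop :=
  ContDiffAt ℝ 2 F x ∧ fderiv ℝ F x ≠ 0 ∧ ∀ᶠ y in 𝓝 x, (y ∈ M ↔ F y = 0)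

namespace IsLocalEquation

variable {M : Set E3} {F : E3 → ℝ} {x : E3}

theorem eventually (h : IsLocalEquation M F x) : ∀ᶠ y in 𝓝 x, IsLocalEquation M F y := by
  have h1 : ContinuousAt (fderiv ℝ F) x :=
    (h.1.fderiv_right (m := 1) (by rw [one_add_one_eq_two])).continuousAt
  filter_upwards [h.1.eventually (by simp), h1.eventually_ne h.2.1,
    eventually_eventually_nhds.2 h.2.2] with y a b c
  exact ⟨a, b, c⟩

theorem range_eq_top (h : IsLocalEquation M F x) :
    ((fderiv ℝ F x : E3 →L[ℝ] ℝ) : E3 →ₗ[ℝ] ℝ).range = ⊤ :=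
  LinearMap.range_eq_top.2 (LinearMap.surjective fun h0 => h.2.1 (by
    ext v; exact LinearMap.congr_fun h0 v))

/-- A local parametrization of the surface by its tangent plane. -/
theorem exists_parametrization (h : IsLocalEquation M F x) (hx : x ∈ M) :
    ∃ (g : ((fderiv ℝ F x : E3 →L[ℝ] ℝ) : E3 →ₗ[ℝ] ℝ).ker → E3)
      (p : E3 → ((fderiv ℝ F x : E3 →L[ℝ] ℝ) : E3 →ₗ[ℝ] ℝ).ker),
      HasStrictFDerivAt g ((fderiv ℝ F x : E3 →L[ℝ] ℝ) : E3 →ₗ[ℝ] ℝ).ker.subtypeL 0 ∧ g 0 = x ∧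
      (∀ᶠ w in 𝓝 0, g w ∈ M) ∧ Tendsto p (𝓝 x) (𝓝 0) ∧ ∀ᶠ y in 𝓝[M] x, g (p y) = y := by
  have hs : HasStrictFDerivAt F (fderiv ℝ F x) x := h.1.hasStrictFDerivAt (by norm_num)
  have hr := h.range_eq_top
  have hFx : F x = 0 := (h.2.2.self_of_nhds).1 hx
  have h0 := hs.implicitFunction_apply_image hr
  have hd := hs.to_implicitFunction hr
  refine ⟨hs.implicitFunction F _ hr (F x),
    fun y => (hs.implicitToOpenPartialHomeomorph F _ hr y).2, hd, h0, ?_, ?_, ?_⟩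
  · have h1 : Tendsto (hs.implicitFunction F _ hr (F x)) (𝓝 0) (𝓝 x) := by
      simpa [ContinuousAt, h0] using hd.continuousAt
    have h2 := hs.map_implicitFunction_eq hr
    rw [nhds_prod_eq] at h2
    filter_upwards [h1.eventually h.2.2, h2.curry.self_of_nhds] with w hw hw'
    rw [hw, hw', hFx]
  · have h1 : ContinuousAt (hs.implicitToOpenPartialHomeomorph F _ hr) x :=
      (hs.implicitToOpenPartialHomeomorph F _ hr).continuousAt
        (hs.mem_implicitToOpenPartialHomeomorph_source hr)
    have h2 := h1.snd
    rw [ContinuousAt, hs.implicitToOpenPartialHomeomorph_self hr] at h2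
    exact h2
  · have h1 := hs.eq_implicitFunction hr
    filter_upwards [h1.filter_mono nhdsWithin_le_nhds, h.2.2.filter_mono nhdsWithin_le_nhds,
      self_mem_nhdsWithin] with y hy hy' hyM
    rwa [hy'.1 hyM, ← hFx] at hy

theorem fderiv_eq_zero_of_hasDerivAt (h : IsLocalEquation M F x) {c : ℝ → E3} {v : E3} {t : ℝ}
    (hc : HasDerivAt c v t) (hx : c t = x) (hM : ∀ᶠ s in 𝓝 t, c s ∈ M) : fderiv ℝ F x v = 0 := by
  have h1 : HasFDerivAt F (fderiv ℝ F (c t)) (c t) := by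
    rw [hx]; exact (h.1.differentiableAt (by norm_num)).hasFDerivAt
  have h2 := h1.comp_hasDerivAt t hc
  have h3 : F ∘ c =ᶠ[𝓝 t] fun _ => 0 := by
    have h4 : Tendsto c (𝓝 t) (𝓝 x) := hx ▸ hc.continuousAt
    filter_upwards [h4.eventually h.2.2, hM] with s a b using a.1 b
  have h4 := (hasDerivAt_const t (0 : ℝ)).congr_of_eventuallyEq h3
  rw [← hx]
  exact h2.unique h4

theorem exists_curve (h : IsLocalEquation M F x) (hx : x ∈ M) {v : E3} (hv : fderiv ℝ F x v = 0) :
    ∃ c : ℝ → E3, HasDerivAt c v 0 ∧ c 0 = x ∧ ∀ᶠ t in 𝓝 0, c t ∈ M := by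
  obtain ⟨g, p, hg, hg0, hgM, -, -⟩ := h.exists_parametrization hx
  have hl : HasDerivAt (fun t : ℝ => t • (⟨v, hv⟩ :
      ((fderiv ℝ F x : E3 →L[ℝ] ℝ) : E3 →ₗ[ℝ] ℝ).ker)) ⟨v, hv⟩ 0 := by
    simpa using (hasDerivAt_id (0 : ℝ)).smul_const (⟨v, hv⟩ :
      ((fderiv ℝ F x : E3 →L[ℝ] ℝ) : E3 →ₗ[ℝ] ℝ).ker)
  refine ⟨fun t => g (t • ⟨v, hv⟩), ?_, by simpa using hg0, ?_⟩
  · have h1 : HasFDerivAt g (((fderiv ℝ F x : E3 →L[ℝ] ℝ) : E3 →ₗ[ℝ] ℝ).ker.subtypeL)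
        ((0 : ℝ) • ⟨v, hv⟩) := by
      rw [zero_smul]; exact hg.hasFDerivAt
    exact h1.comp_hasDerivAt (0 : ℝ) hl
  · have h2 := hl.continuousAt
    rw [ContinuousAt, zero_smul] at h2
    exact h2.eventually hgM

/-- The tangent plane is the kernel of the differential of a local equation. -/
theorem mem_tangentPlane_iff (h : IsLocalEquation M F x) (hx : x ∈ M) {v : E3} :
    v ∈ tangentPlane M x ↔ fderiv ℝ F x v = 0 := by
  constructor
  · intro hv
    -- `F` maps `M` near `x` into `{0}`, so its differential maps the tangent cone into the tangent
    -- cone of a point, which is zero.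
    have : tangentPlane M x ≤ ((fderiv ℝ F x : E3 →L[ℝ] ℝ) : E3 →ₗ[ℝ] ℝ).ker := by
      refine Submodule.span_le.2 fun u hu => ?_
      have h1 : tangentConeAt ℝ M x ⊆ tangentConeAt ℝ (M ∩ {y | y ∈ M ↔ F y = 0}) x :=
        (tangentConeAt_inter_nhds h.2.2).ge
      have h2 : HasFDerivWithinAt F (fderiv ℝ F x) (M ∩ {y | y ∈ M ↔ F y = 0}) x :=
        (h.1.differentiableAt (by norm_num)).hasFDerivAt.hasFDerivWithinAt
      have h3 := h2.mapsTo_tangent_cone (h1 hu)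
      have h4 : F '' (M ∩ {y | y ∈ M ↔ F y = 0}) ⊆ {0} := by
        rintro _ ⟨y, ⟨hy, hy'⟩, rfl⟩
        exact hy'.1 hy
      have h5 := tangentConeAt_mono h4 h3
      have h6 := tangentConeAt_subset_zero (by
          rw [(h.2.2.self_of_nhds).1 hx, accPt_iff_frequently]
          exact fun h0 => h0.exists.elim fun y hy => hy.1 hy.2) h5
      simpa using h6
    exact this hv
  · intro hv
    obtain ⟨c, hc, hc0, hcM⟩ := h.exists_curve hx hv
    refine Submodule.subset_span ?_
    have h1 := hasDerivAt_iff_tendsto_slope.1 hc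
    refine mem_tangentConeAt_of_seq (𝓝[≠] (0 : ℝ)) (fun t => t⁻¹) (fun t => c t - x) ?_ ?_ ?_
    · have h2 : Tendsto c (𝓝[≠] 0) (𝓝 x) := (hc0 ▸ hc.continuousAt.tendsto).mono_left
        nhdsWithin_le_nhds
      simpa using h2.sub_const x
    · filter_upwards [hcM.filter_mono nhdsWithin_le_nhds] with t ht
      simpa using ht
    · refine h1.congr fun t => ?_
      simp [slope, hc0]

theorem finrank_tangentPlane (h : IsLocalEquation M F x) (hx : x ∈ M) :
    Module.finrank ℝ (tangentPlane M x) = 2 := by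
  have h1 : tangentPlane M x = ((fderiv ℝ F x : E3 →L[ℝ] ℝ) : E3 →ₗ[ℝ] ℝ).ker := by
    ext v; exact h.mem_tangentPlane_iff hx
  have h2 := Module.Dual.finrank_ker_add_one_of_ne_zero
    (f := ((fderiv ℝ F x : E3 →L[ℝ] ℝ) : E3 →ₗ[ℝ] ℝ))
    (fun h0 => h.2.1 (by ext v; exact LinearMap.congr_fun h0 v))
  rw [finrank_euclideanSpace_fin] at h2
  rw [h1]; omega

/-- Near a point, the intrinsic distance is almost the Euclidean one. -/
theorem eventually_surfaceEDist_le (h : IsLocalEquation M F x) (hx : x ∈ M) {ε : ℝ} (hε : 0 < ε) :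
    ∀ᶠ q in 𝓝[M] x ×ˢ 𝓝[M] x, surfaceEDist M q.1 q.2 ≤ ENNReal.ofReal ((1 + ε) * ‖q.1 - q.2‖) := by
  obtain ⟨g, p, hg, hg0, hgM, hp, hgp⟩ := h.exists_parametrization hx
  -- The solution of `1 + δ = (1 + ε) * (1 - δ)`. Near `0` the parametrization differs from the
  -- inclusion of the tangent plane by a `δ`-Lipschitz map, so it distorts lengths by factors
  -- between `1 - δ` and `1 + δ`; the competing curve is the lift of the segment from `w` to `w'`.
  set δ : ℝ := ε / (2 + ε) with hδ
  have hδ0 : 0 < δ := by positivity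
  have hδ1 : (1 + δ) = (1 + ε) * (1 - δ) := by
    rw [hδ]; field_simp; ring
  obtain ⟨s, hs, hsg⟩ := hg.approximates_deriv_on_nhds (c := δ.toNNReal)
    (Or.inr (Real.toNNReal_pos.2 hδ0))
  obtain ⟨r, hr, hrs⟩ := Metric.mem_nhds_iff.1 (inter_mem hs hgM)
  have hpb : ∀ᶠ y in 𝓝[M] x, p y ∈ Metric.ball 0 r ∧ g (p y) = y :=
    ((hp.eventually (Metric.ball_mem_nhds _ hr)).filter_mono nhdsWithin_le_nhds).and hgp
  filter_upwards [hpb.prod_mk hpb] with q hq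
  obtain ⟨⟨hw, hgw⟩, ⟨hw', hgw'⟩⟩ := hq
  set w := p q.1
  set w' := p q.2
  have happ : ∀ a ∈ Metric.ball 0 r, ∀ b ∈ Metric.ball 0 r,
      ‖g a - g b - ((a : E3) - b)‖ ≤ δ * ‖a - b‖ := by
    intro a ha b hb
    have := hsg a (hrs ha).1 b (hrs hb).1
    rw [Real.coe_toNNReal _ hδ0.le] at this
    simpa using this
  have h1 : (1 - δ) * ‖w - w'‖ ≤ ‖q.1 - q.2‖ := by
    have h2 := happ w hw w' hw'
    rw [hgw, hgw'] at h2
    have h3 : ‖w - w'‖ = ‖((w : E3) - w')‖ := rfl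
    have h4 := norm_sub_norm_le ((w : E3) - w') (q.1 - q.2)
    rw [norm_sub_rev ((w : E3) - w') (q.1 - q.2)] at h4
    linarith
  have hseg : ∀ t ∈ Icc (0 : ℝ) 1, AffineMap.lineMap w w' t ∈ Metric.ball
      (0 : ((fderiv ℝ F x : E3 →L[ℝ] ℝ) : E3 →ₗ[ℝ] ℝ).ker) r := fun t ht =>
    (convex_ball _ _).segment_subset hw hw' (segment_eq_image_lineMap ℝ w w' ▸ ⟨t, ht, rfl⟩)
  have hlip : LipschitzOnWith ((1 + δ) * ‖w - w'‖).toNNReal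
      (fun t : ℝ => g (AffineMap.lineMap w w' t)) (Icc 0 1) := by
    refine LipschitzOnWith.of_dist_le_mul fun a ha b hb => ?_
    rw [Real.coe_toNNReal _ (by positivity), dist_eq_norm]
    set A := (AffineMap.lineMap w w' a : ((fderiv ℝ F x : E3 →L[ℝ] ℝ) : E3 →ₗ[ℝ] ℝ).ker)
    set B := (AffineMap.lineMap w w' b : ((fderiv ℝ F x : E3 →L[ℝ] ℝ) : E3 →ₗ[ℝ] ℝ).ker)
    have h2 := happ _ (hseg a ha) _ (hseg b hb)
    have h3 : ‖A - B‖ = dist a b * ‖w - w'‖ := by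
      rw [← dist_eq_norm, dist_lineMap_lineMap, dist_eq_norm w]
    have h4 := norm_sub_norm_le (g A - g B) ((A : E3) - B)
    have h5 : ‖A - B‖ = ‖((A : E3) - B)‖ := rfl
    calc ‖g A - g B‖ ≤ (1 + δ) * ‖A - B‖ := by linarith
      _ = _ := by rw [h3]; ring
  have h6 := surfaceEDist_le_of_lipschitzOnWith (M := M) zero_le_one hlip
    fun t ht => (hrs (hseg t ht)).2
  simp only [AffineMap.lineMap_apply_zero, AffineMap.lineMap_apply_one, sub_zero,
    ENNReal.ofReal_one, mul_one, hgw, hgw'] at h6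
  refine h6.trans (ENNReal.ofReal_le_ofReal ?_)
  rw [hδ1, mul_assoc]
  gcongr

end IsLocalEquation

/-- The orthogonal projection of three-space onto the normal line at a point of `M`. -/
noncomputable def normalProj (M : Set E3) (x : E3) : E3 →L[ℝ] E3 :=
  (tangentPlane M x)ᗮ.starProjection

theorem normalProj_of_mem {M : Set E3} {x v : E3} (hv : v ∈ tangentPlane M x) :
    normalProj M x v = 0 := by
  rw [normalProj, Submodule.starProjection_apply_eq_zero_iff]
  exact Submodule.le_orthogonal_orthogonal _ hv

theorem normalProj_of_orthogonal {M : Set E3} {x v : E3}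
    (hv : ∀ u ∈ tangentPlane M x, inner ℝ v u = 0) : normalProj M x v = v := by
  rw [normalProj, Submodule.starProjection_eq_self_iff, Submodule.mem_orthogonal']
  exact hv

namespace IsLocalEquation

variable {M : Set E3} {F : E3 → ℝ} {x : E3}

/-- The normal line is spanned by the gradient of `F`. The formula makes the projection as regular
as `fderiv ℝ F`, hence `C¹`. -/
theorem normalProj_eq (h : IsLocalEquation M F x) (hx : x ∈ M) :
    normalProj M x = (‖fderiv ℝ F x‖ ^ 2)⁻¹ • (fderiv ℝ F x).smulRight
      ((InnerProductSpace.toDual ℝ E3).symm (fderiv ℝ F x)) := by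
  set n := (InnerProductSpace.toDual ℝ E3).symm (fderiv ℝ F x) with hn
  have h1 : (tangentPlane M x)ᗮ = Submodule.span ℝ {n} := by
    rw [← Submodule.orthogonal_orthogonal (Submodule.span ℝ {n})]
    congr 1
    ext v
    rw [h.mem_tangentPlane_iff hx, Submodule.mem_orthogonal_singleton_iff_inner_right, hn,
      InnerProductSpace.toDual_symm_apply]
  ext1 v
  have h2 : ‖n‖ = ‖fderiv ℝ F x‖ := by rw [hn, LinearIsometryEquiv.norm_map]
  have h3 : inner ℝ n v = fderiv ℝ F x v := by rw [hn, InnerProductSpace.toDual_symm_apply]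
  simp only [normalProj, h1, Submodule.starProjection_singleton, h2, h3]
  simp [smul_smul, div_eq_inv_mul]

/-- The normal projection is, locally along the surface, a `C¹` function. -/
theorem exists_contDiffAt_normalProj (h : IsLocalEquation M F x) :
    ∃ G : E3 → E3 →L[ℝ] E3, ContDiffAt ℝ 1 G x ∧ ∀ᶠ y in 𝓝[M] x, normalProj M y = G y := by
  refine ⟨fun y => (‖fderiv ℝ F y‖ ^ 2)⁻¹ • ContinuousLinearMap.smulRightL ℝ E3 E3 (fderiv ℝ F y)
      ((InnerProductSpace.toDual ℝ E3).symm (fderiv ℝ F y)), ?_, ?_⟩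
  · have h1 : ContDiffAt ℝ 1 (fderiv ℝ F) x :=
      h.1.fderiv_right (by rw [one_add_one_eq_two])
    have h2 : ContDiffAt ℝ 1 (fun y => (InnerProductSpace.toDual ℝ E3).symm (fderiv ℝ F y)) x :=
      ((InnerProductSpace.toDual ℝ E3).symm.toContinuousLinearEquiv.contDiff.contDiffAt).comp x h1
    have h3 : (fun y => ‖fderiv ℝ F y‖ ^ 2) =
        fun y => ‖(InnerProductSpace.toDual ℝ E3).symm (fderiv ℝ F y)‖ ^ 2 := by
      funext y; rw [LinearIsometryEquiv.norm_map]
    have h4 : ContDiffAt ℝ 1 (fun y => ‖fderiv ℝ F y‖ ^ 2) x := by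
      rw [h3]; exact h2.norm_sq ℝ
    refine (h4.inv (by simpa using h.2.1)).smul ?_
    exact (((ContinuousLinearMap.smulRightL ℝ E3 E3).contDiff.contDiffAt).comp x h1).clm_apply h2
  · filter_upwards [h.eventually.filter_mono nhdsWithin_le_nhds, self_mem_nhdsWithin] with y hy hyM
    exact hy.normalProj_eq hyM

end IsLocalEquation

/-! ### Consequences for `C²` surfaces -/

namespace IsC2Surface

variable {M : Set E3}

theorem exists_isLocalEquation (hM : IsC2Surface M) {x : E3} (hx : x ∈ M) :
    ∃ F, IsLocalEquation M F x := hM x hx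

/-- Compactness turns local Lipschitz bounds into one constant, which then controls all unit-speed
geodesics of `M` without charts. -/
theorem exists_lipschitzOnWith_normalProj (hM : IsC2Surface M) (hc : IsCompact M) :
    ∃ L, LipschitzOnWith L (normalProj M) M := by
  refine LocallyLipschitzOn.exists_lipschitzOnWith_of_compact hc fun x hx => ?_
  obtain ⟨F, hF⟩ := hM.exists_isLocalEquation hx
  obtain ⟨G, hG, hGe⟩ := hF.exists_contDiffAt_normalProj
  obtain ⟨K, t, ht, hK⟩ := hG.exists_lipschitzOnWith
  refine ⟨K, _, inter_mem (inter_mem (mem_nhdsWithin_of_mem_nhds ht) hGe) self_mem_nhdsWithin, ?_⟩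
  intro y hy z hz
  rw [hy.1.2, hz.1.2]
  exact hK hy.1.1 hz.1.1

theorem deriv_mem_tangentPlane (hM : IsC2Surface M) {c : ℝ → E3} {v : E3} {t : ℝ}
    (hc : HasDerivAt c v t) (hcM : ∀ s, c s ∈ M) : v ∈ tangentPlane M (c t) := by
  obtain ⟨F, hF⟩ := hM.exists_isLocalEquation (hcM t)
  exact (hF.mem_tangentPlane_iff (hcM t)).2
    (hF.fderiv_eq_zero_of_hasDerivAt hc rfl (Eventually.of_forall hcM))

theorem differentiableAt_normalProj_comp (hM : IsC2Surface M) {c : ℝ → E3} {t : ℝ}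
    (hc : DifferentiableAt ℝ c t) (hcM : ∀ s, c s ∈ M) :
    DifferentiableAt ℝ (fun s => normalProj M (c s)) t := by
  obtain ⟨F, hF⟩ := hM.exists_isLocalEquation (hcM t)
  obtain ⟨G, hG, hGe⟩ := hF.exists_contDiffAt_normalProj
  have h1 : DifferentiableAt ℝ (G ∘ c) t := (hG.differentiableAt (by norm_num)).comp t hc
  refine h1.congr_of_eventuallyEq ?_
  have h2 : Tendsto c (𝓝 t) (𝓝[M] (c t)) :=
    tendsto_nhdsWithin_iff.2 ⟨hc.continuousAt, Eventually.of_forall hcM⟩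
  exact h2.eventually hGe

theorem eventually_surfaceEDist_le (hM : IsC2Surface M) {x : E3} (hx : x ∈ M) {ε : ℝ}
    (hε : 0 < ε) : ∀ᶠ q in 𝓝[M] x ×ˢ 𝓝[M] x,
      surfaceEDist M q.1 q.2 ≤ ENNReal.ofReal ((1 + ε) * ‖q.1 - q.2‖) := by
  obtain ⟨F, hF⟩ := hM.exists_isLocalEquation hx
  exact hF.eventually_surfaceEDist_le hx hε

theorem tendsto_surfaceEDist (hM : IsC2Surface M) {x : E3} (hx : x ∈ M) :
    Tendsto (fun y => surfaceEDist M y x) (𝓝[M] x) (𝓝 0) := by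
  have h1 := (hM.eventually_surfaceEDist_le hx one_pos).curry
  have h2 : ∀ᶠ y in 𝓝[M] x, surfaceEDist M y x ≤ ENNReal.ofReal ((1 + 1) * ‖y - x‖) := by
    filter_upwards [h1] with y hy using hy.self_of_nhdsWithin hx
  have h3 : Tendsto (fun y => ENNReal.ofReal ((1 + 1) * ‖y - x‖)) (𝓝[M] x) (𝓝 0) := by
    have : Continuous fun y : E3 => ENNReal.ofReal ((1 + 1) * ‖y - x‖) :=
      ENNReal.continuous_ofReal.comp (by fun_prop)
    have h4 := this.tendsto x
    simp only [sub_self, norm_zero, mul_zero, ENNReal.ofReal_zero] at h4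
    exact h4.mono_left nhdsWithin_le_nhds
  exact tendsto_of_tendsto_of_tendsto_of_le_of_le' tendsto_const_nhds h3
    (Eventually.of_forall fun _ => zero_le) h2

/-- Continuity of the intrinsic distance in both variables. -/
theorem tendsto_surfaceDist (hM : IsC2Surface M) {ι : Type*} {l : Filter ι} {x y : E3}
    {u v : ι → E3} (hx : x ∈ M) (hy : y ∈ M) (hu : Tendsto u l (𝓝[M] x))
    (hv : Tendsto v l (𝓝[M] y)) (hxy : surfaceEDist M x y ≠ ⊤) :
    Tendsto (fun i => surfaceDist M (u i) (v i)) l (𝓝 (surfaceDist M x y)) ∧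
      ∀ᶠ i in l, surfaceEDist M (u i) (v i) ≠ ⊤ := by
  have hu1 := (hM.tendsto_surfaceEDist hx).comp hu
  have hv1 := (hM.tendsto_surfaceEDist hy).comp hv
  have hu2 : ∀ᶠ i in l, surfaceEDist M (u i) x ≠ ⊤ :=
    (hu1.eventually (gt_mem_nhds ENNReal.zero_lt_top)).mono fun i hi => ne_of_lt hi
  have hv2 : ∀ᶠ i in l, surfaceEDist M (v i) y ≠ ⊤ :=
    (hv1.eventually (gt_mem_nhds ENNReal.zero_lt_top)).mono fun i hi => ne_of_lt hi
  have hu3 : Tendsto (fun i => surfaceDist M (u i) x) l (𝓝 0) :=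
    (ENNReal.tendsto_toReal ENNReal.zero_ne_top).comp hu1
  have hv3 : Tendsto (fun i => surfaceDist M (v i) y) l (𝓝 0) :=
    (ENNReal.tendsto_toReal ENNReal.zero_ne_top).comp hv1
  have hfin : ∀ᶠ i in l, surfaceEDist M (u i) (v i) ≠ ⊤ := by
    filter_upwards [hu2, hv2] with i a b
    exact surfaceEDist_ne_top_trans (surfaceEDist_ne_top_trans a hxy)
      (by rwa [surfaceEDist_comm])
  refine ⟨?_, hfin⟩
  rw [tendsto_iff_dist_tendsto_zero]
  have h0 := hu3.add hv3
  rw [add_zero] at h0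
  refine squeeze_zero' (Eventually.of_forall fun _ => dist_nonneg) ?_ h0
  filter_upwards [hu2, hv2, hfin] with i a b c
  have a' : surfaceEDist M x (u i) ≠ ⊤ := by rwa [surfaceEDist_comm]
  have b' : surfaceEDist M y (v i) ≠ ⊤ := by rwa [surfaceEDist_comm]
  have t1 := surfaceDist_triangle (surfaceEDist_ne_top_trans a hxy) b'
  have t2 := surfaceDist_triangle a hxy
  have t3 := surfaceDist_triangle (surfaceEDist_ne_top_trans a' c) b
  have t4 := surfaceDist_triangle a' c
  rw [surfaceDist_comm M y] at t1
  rw [surfaceDist_comm M x (u i)] at t4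
  rw [Real.dist_eq, abs_le]
  constructor <;> linarith

theorem finrank_tangentPlane (hM : IsC2Surface M) {x : E3} (hx : x ∈ M) :
    Module.finrank ℝ (tangentPlane M x) = 2 := by
  obtain ⟨F, hF⟩ := hM.exists_isLocalEquation hx
  exact hF.finrank_tangentPlane hx

theorem exists_curve (hM : IsC2Surface M) {x v : E3} (hx : x ∈ M) (hv : v ∈ tangentPlane M x) :
    ∃ c : ℝ → E3, HasDerivAt c v 0 ∧ c 0 = x ∧ ∀ᶠ t in 𝓝 0, c t ∈ M := by
  obtain ⟨F, hF⟩ := hM.exists_isLocalEquation hx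
  exact hF.exists_curve hx ((hF.mem_tangentPlane_iff hx).1 hv)

end IsC2Surface

/-! ### Dependence of geodesics on initial data -/

namespace IsGeodesic

variable {M : Set E3} {γ σ : ℝ → E3} {L : NNReal}

theorem deriv_mem_tangentPlane (h : IsGeodesic M γ) (hM : IsC2Surface M) (t : ℝ) :
    deriv γ t ∈ tangentPlane M (γ t) :=
  hM.deriv_mem_tangentPlane (h.hasDerivAt t) h.2.1

/-- A geodesic has constant speed. -/
theorem norm_deriv_eq (h : IsGeodesic M γ) (hM : IsC2Surface M) (t : ℝ) :
    ‖deriv γ t‖ = ‖deriv γ 0‖ := by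
  have h1 : ∀ s, HasDerivAt (fun s => ‖deriv γ s‖ ^ 2) 0 s := fun s => by
    have h2 := (h.hasDerivAt_deriv s).norm_sq
    rwa [real_inner_comm, h.2.2 s _ (h.deriv_mem_tangentPlane hM s), mul_zero] at h2
  have h3 := is_const_of_deriv_eq_zero (fun s => (h1 s).differentiableAt) (fun s => (h1 s).deriv) t 0
  exact (sq_eq_sq₀ (norm_nonneg _) (norm_nonneg _)).1 h3

theorem hasDerivAt_normalProj (h : IsGeodesic M γ) (hM : IsC2Surface M) (t : ℝ) :
    HasDerivAt (fun s => normalProj M (γ s)) (deriv (fun s => normalProj M (γ s)) t) t :=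
  (hM.differentiableAt_normalProj_comp (h.differentiable t) h.2.1).hasDerivAt

theorem norm_deriv_normalProj_le (h : IsGeodesic M γ) (h1 : ∀ t, ‖deriv γ t‖ = 1)
    (hL : LipschitzOnWith L (normalProj M) M) (t : ℝ) :
    ‖deriv (fun s => normalProj M (γ s)) t‖ ≤ L := by
  refine norm_deriv_le_of_lipschitz ?_
  have := hL.comp (h.lipschitzWith h1).lipschitzOnWith (fun s _ => h.2.1 s : MapsTo γ univ M)
  rw [mul_one] at this
  exact lipschitzOnWith_univ.1 this

/-- Differentiate `normalProj M (γ s) (deriv γ s) = 0` and use that the acceleration is normal: the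
geodesic equation in extrinsic form. -/
theorem deriv_deriv_eq (h : IsGeodesic M γ) (hM : IsC2Surface M) (t : ℝ) :
    deriv (deriv γ) t = -(deriv (fun s => normalProj M (γ s)) t (deriv γ t)) := by
  have h1 := (h.hasDerivAt_normalProj hM t).clm_apply (h.hasDerivAt_deriv t)
  have h2 : (fun s => normalProj M (γ s) (deriv γ s)) = fun _ => 0 :=
    funext fun s => normalProj_of_mem (h.deriv_mem_tangentPlane hM s)
  rw [h2] at h1
  have h3 := h1.unique (hasDerivAt_const t (0 : E3))
  rw [normalProj_of_orthogonal (h.2.2 t)] at h3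
  exact eq_neg_of_add_eq_zero_right h3

theorem norm_deriv_deriv_le (h : IsGeodesic M γ) (hM : IsC2Surface M)
    (h1 : ∀ t, ‖deriv γ t‖ = 1) (hL : LipschitzOnWith L (normalProj M) M) (t : ℝ) :
    ‖deriv (deriv γ) t‖ ≤ L := by
  rw [h.deriv_deriv_eq hM, norm_neg]
  refine (ContinuousLinearMap.le_opNorm _ _).trans ?_
  rw [h1, mul_one]
  exact h.norm_deriv_normalProj_le h1 hL t

/-- A Taylor bound uniform over all unit-speed geodesics. It recovers the initial direction from the
position at one small time. -/
theorem norm_sub_sub_le (h : IsGeodesic M γ) (hM : IsC2Surface M)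
    (h1 : ∀ t, ‖deriv γ t‖ = 1) (hL : LipschitzOnWith L (normalProj M) M) {s : ℝ} (hs : 0 ≤ s) :
    ‖γ s - γ 0 - s • deriv γ 0‖ ≤ L * s ^ 2 := by
  have h2 : ∀ t ∈ Icc 0 s, HasDerivWithinAt (fun t => γ t - t • deriv γ 0)
      (deriv γ t - deriv γ 0) (Icc 0 s) t := fun t _ => by
    have := (h.hasDerivAt t).sub ((hasDerivAt_id t).smul_const (deriv γ 0))
    rw [one_smul] at this
    exact this.hasDerivWithinAt
  have h3 : ∀ t ∈ Ico 0 s, ‖deriv γ t - deriv γ 0‖ ≤ L * s := fun t ht => by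
    have := (convex_univ : Convex ℝ (univ : Set ℝ)).norm_image_sub_le_of_norm_deriv_le
      (f := deriv γ) (fun x _ => h.differentiable_deriv x)
      (fun x _ => h.norm_deriv_deriv_le hM h1 hL x) (mem_univ 0) (mem_univ t)
    refine this.trans ?_
    rw [sub_zero, Real.norm_of_nonneg ht.1]
    exact mul_le_mul_of_nonneg_left ht.2.le L.2
  have h4 := norm_image_sub_le_of_norm_deriv_le_segment' h2 h3 s ⟨hs, le_rfl⟩
  calc ‖γ s - γ 0 - s • deriv γ 0‖ = ‖γ s - s • deriv γ 0 - (γ 0 - (0 : ℝ) • deriv γ 0)‖ := by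
        congr 1; simp only [zero_smul]; abel
    _ ≤ L * s * (s - 0) := h4
    _ = L * s ^ 2 := by ring

/-- Geodesics with the same origin diverge at most exponentially. -/
theorem norm_sub_le_exp (h : IsGeodesic M γ) (h' : IsGeodesic M σ) (hM : IsC2Surface M)
    (h1 : ∀ t, ‖deriv γ t‖ = 1) (h1' : ∀ t, ‖deriv σ t‖ = 1)
    (hL : LipschitzOnWith L (normalProj M) M) (h0 : γ 0 = σ 0) {t : ℝ} (ht : 0 ≤ t) :
    ‖γ t - σ t‖ ≤ ‖deriv γ 0 - deriv σ 0‖ * Real.exp ((1 + 2 * L + 2 * L ^ 2) * t) := by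
  set d : ℝ → E3 := fun t => γ t - σ t with hd
  set N : ℝ → E3 →L[ℝ] E3 := fun t => normalProj M (σ t) with hN
  -- On a `C²` surface the normal projection is only `C¹`, so accelerations, which involve its
  -- derivative, need not be Lipschitz in position. Gronwall is therefore applied to `d` and the
  -- part `T` of the velocity difference tangent at `σ t`: in `T'` the acceleration of `σ` cancels
  -- and that of `γ` meets only a difference of projections. The normal part is bounded by `L * ‖d
  -- t‖`.
  set T : ℝ → E3 := fun t => (deriv γ t - deriv σ t) - N t (deriv γ t - deriv σ t) with hT
  have hNσ : ∀ t, N t (deriv σ t) = 0 := fun t => normalProj_of_mem (h'.deriv_mem_tangentPlane hM t)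
  have hPd : ∀ t, ‖normalProj M (γ t) - N t‖ ≤ L * ‖d t‖ := fun t => by
    have := hL.dist_le_mul _ (h.2.1 t) _ (h'.2.1 t)
    rwa [dist_eq_norm, dist_eq_norm] at this
  have hNd : ∀ t, ‖N t (deriv γ t - deriv σ t)‖ ≤ L * ‖d t‖ := fun t => by
    have h2 : N t (deriv γ t - deriv σ t) = -((normalProj M (γ t) - N t) (deriv γ t)) := by
      rw [map_sub, hNσ, sub_apply,
        normalProj_of_mem (h.deriv_mem_tangentPlane hM t)]
      simp
    rw [h2, norm_neg]
    refine (ContinuousLinearMap.le_opNorm _ _).trans ?_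
    rw [h1, mul_one]
    exact hPd t
  have hdd : ∀ t, ‖deriv γ t - deriv σ t‖ ≤ ‖T t‖ + L * ‖d t‖ := fun t => by
    have h2 : deriv γ t - deriv σ t = T t + N t (deriv γ t - deriv σ t) := by simp [hT]
    calc ‖deriv γ t - deriv σ t‖ = ‖T t + N t (deriv γ t - deriv σ t)‖ := by rw [← h2]
      _ ≤ _ := (norm_add_le _ _).trans (add_le_add le_rfl (hNd t))
  have hder : ∀ t, HasDerivAt d (deriv γ t - deriv σ t) t := fun t =>
    (h.hasDerivAt t).sub (h'.hasDerivAt t)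
  set N' : ℝ → E3 →L[ℝ] E3 := fun t => deriv N t with hN'
  have hTder : ∀ t, HasDerivAt T ((deriv (deriv γ) t - deriv (deriv σ) t) -
      (N' t (deriv γ t - deriv σ t) + N t (deriv (deriv γ) t - deriv (deriv σ) t))) t := fun t => by
    have h2 := (h.hasDerivAt_deriv t).sub (h'.hasDerivAt_deriv t)
    exact h2.sub ((h'.hasDerivAt_normalProj hM t).clm_apply h2)
  have hTeq : ∀ t, (deriv (deriv γ) t - deriv (deriv σ) t) -
      (N' t (deriv γ t - deriv σ t) + N t (deriv (deriv γ) t - deriv (deriv σ) t)) =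
      (normalProj M (γ t) - N t) (deriv (deriv γ) t) - N' t (deriv γ t - deriv σ t) := fun t => by
    have h2 : N t (deriv (deriv σ) t) = deriv (deriv σ) t := normalProj_of_orthogonal (h'.2.2 t)
    rw [map_sub (N t), h2, sub_apply, normalProj_of_orthogonal (h.2.2 t)]
    abel
  have hTn : ∀ t, ‖(deriv (deriv γ) t - deriv (deriv σ) t) -
      (N' t (deriv γ t - deriv σ t) + N t (deriv (deriv γ) t - deriv (deriv σ) t))‖ ≤
      2 * L ^ 2 * ‖d t‖ + L * ‖T t‖ := fun t => by
    rw [hTeq]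
    refine (norm_sub_le _ _).trans ?_
    have h2 : ‖(normalProj M (γ t) - N t) (deriv (deriv γ) t)‖ ≤ L * ‖d t‖ * L :=
      (ContinuousLinearMap.le_opNorm _ _).trans (mul_le_mul (hPd t)
        (h.norm_deriv_deriv_le hM h1 hL t) (norm_nonneg _) (by positivity))
    have h3 : ‖N' t (deriv γ t - deriv σ t)‖ ≤ L * (‖T t‖ + L * ‖d t‖) :=
      (ContinuousLinearMap.le_opNorm _ _).trans (mul_le_mul (h'.norm_deriv_normalProj_le h1' hL t)
        (hdd t) (norm_nonneg _) L.2)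
    linarith
  have hpair : ∀ t, HasDerivAt (fun t => (d t, T t)) _ t := fun t => (hder t).prodMk (hTder t)
  have hT0 : ‖((d 0, T 0) : E3 × E3)‖ ≤ ‖deriv γ 0 - deriv σ 0‖ := by
    have h2 : d 0 = 0 := by simp [hd, h0]
    have h3 : N 0 (deriv γ 0 - deriv σ 0) = 0 := by
      have := hNd 0
      rw [h2, norm_zero, mul_zero] at this
      exact norm_le_zero_iff.1 this
    have h4 : T 0 = deriv γ 0 - deriv σ 0 := by
      simp only [hT]
      rw [h3, sub_zero]
    simp [h2, h4]
  have hg := norm_le_gronwallBound_of_norm_deriv_right_le (f := fun t => (d t, T t))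
    (K := 1 + 2 * L + 2 * L ^ 2) (ε := 0) (a := 0) (b := t)
    (fun s _ => (hpair s).continuousAt.continuousWithinAt)
    (fun s _ => (hpair s).hasDerivWithinAt) hT0 ?_ t ⟨ht, le_rfl⟩
  · rw [gronwallBound_ε0, sub_zero] at hg
    exact (norm_fst_le ((d t, T t) : E3 × E3)).trans hg
  · intro s _
    have e1 : ‖d s‖ ≤ ‖((d s, T s) : E3 × E3)‖ := norm_fst_le ((d s, T s) : E3 × E3)
    have e2 : ‖T s‖ ≤ ‖((d s, T s) : E3 × E3)‖ := norm_snd_le ((d s, T s) : E3 × E3)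
    have hL0 : (0 : ℝ) ≤ L := L.2
    set n := ‖((d s, T s) : E3 × E3)‖
    have hn : 0 ≤ n := norm_nonneg _
    have e3 := mul_le_mul_of_nonneg_left e1 hL0
    have e4 := mul_le_mul_of_nonneg_left e2 hL0
    have e5 := mul_le_mul_of_nonneg_left e1 (by positivity : (0 : ℝ) ≤ 2 * L ^ 2)
    have e6 := mul_nonneg hL0 hn
    have e7 : 0 ≤ 2 * (L : ℝ) ^ 2 * n := by positivity
    rw [norm_prod_le_iff]
    constructor
    · refine (hdd s).trans ?_
      linarith
    · refine (hTn s).trans ?_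
      linarith

/-- Uniqueness of geodesics with given initial data. -/
theorem eq_of_initial (h : IsGeodesic M γ) (h' : IsGeodesic M σ) (hM : IsC2Surface M)
    (hc : IsCompact M) (h1 : ∀ t, ‖deriv γ t‖ = 1) (h1' : ∀ t, ‖deriv σ t‖ = 1)
    (h0 : γ 0 = σ 0) (hd : deriv γ 0 = deriv σ 0) : γ = σ := by
  obtain ⟨L, hL⟩ := hM.exists_lipschitzOnWith_normalProj hc
  funext t
  rcases le_total 0 t with ht | ht
  · have := h.norm_sub_le_exp h' hM h1 h1' hL h0 ht
    rw [hd, sub_self, norm_zero, zero_mul] at this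
    exact sub_eq_zero.1 (norm_le_zero_iff.1 this)
  · have := (h.affine (-1) 0).norm_sub_le_exp (h'.affine (-1) 0) hM
      (IsShortestGeodesic.norm_deriv_affine h h1 (by simp) 0)
      (IsShortestGeodesic.norm_deriv_affine h' h1' (by simp) 0) hL (by simpa using h0)
      (neg_nonneg.2 ht)
    have e : deriv (fun t => γ (-1 * t + 0)) 0 = deriv (fun t => σ (-1 * t + 0)) 0 := by
      rw [h.deriv_affine, h'.deriv_affine]
      simp [hd]
    rw [e, sub_self, norm_zero, zero_mul] at this
    simpa [sub_eq_zero] using this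

end IsGeodesic

/-! ### The first variation of weighted sums of distances -/

section FirstVariation

variable {M : Set E3} {P : E3} {ι : Type*} [Fintype ι] {V : ι → E3} {w : ι → ℝ}
  {γ : ι → ℝ → E3}

/-- Differentiability of the distance is not needed. For a curve `c` with velocity `v`, going from
`c t` to `γ i t` and on along the arc bounds the distance from `c t` to `V i` by `(1 + ε) * ‖c t - γ
i t‖ + (surfaceDist M P (V i) - t)`. Insert this in the minimality, divide by `t` and let `t` tend
to `0`. -/
theorem first_variation_aux (hM : IsC2Surface M) (hP : P ∈ M) (hw : ∀ i, 0 ≤ w i)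
    (hγ : ∀ i, IsShortestGeodesic M P (V i) (γ i)) (hne : ∀ i, P ≠ V i)
    (hmin : ∀ᶠ X in 𝓝[M] P, ∑ i, w i * surfaceDist M P (V i) ≤ ∑ i, w i * surfaceDist M X (V i))
    {v : E3} (hv : v ∈ tangentPlane M P) {ε : ℝ} (hε : 0 < ε) :
    0 ≤ ∑ i, w i * ((1 + ε) * ‖v - deriv (γ i) 0‖ - 1) := by
  obtain ⟨c, hc, hc0, hcM⟩ := hM.exists_curve hP hv
  have hcP : Tendsto c (𝓝[>] 0) (𝓝[M] P) :=
    tendsto_nhdsWithin_iff.2 ⟨(hc0 ▸ hc.continuousAt.tendsto).mono_left nhdsWithin_le_nhds,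
      hcM.filter_mono nhdsWithin_le_nhds⟩
  have hγP : ∀ i, Tendsto (γ i) (𝓝[>] 0) (𝓝[M] P) := fun i => by
    have h1 := ((hγ i).1.1.continuous.tendsto 0).mono_left
      (nhdsWithin_le_nhds : 𝓝[>] (0 : ℝ) ≤ 𝓝 0)
    rw [(hγ i).2.2.1] at h1
    exact tendsto_nhdsWithin_iff.2 ⟨h1, Eventually.of_forall (hγ i).1.2.1⟩
  have hlim : Tendsto (fun t => ∑ i, w i * ((1 + ε) * ‖t⁻¹ • (c t - γ i t)‖ - 1)) (𝓝[>] 0)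
      (𝓝 (∑ i, w i * ((1 + ε) * ‖v - deriv (γ i) 0‖ - 1))) := by
    refine tendsto_finsetSum _ fun i _ => ?_
    refine (((?_ : Tendsto _ _ _).norm.const_mul _).sub_const _).const_mul _
    have h1 := hasDerivAt_iff_tendsto_slope.1 (hc.sub ((hγ i).1.hasDerivAt 0))
    refine (h1.mono_left (nhdsWithin_mono _ fun t (ht : 0 < t) => ht.ne')).congr fun t => ?_
    simp [slope, hc0, (hγ i).2.2.1]
  refine ge_of_tendsto hlim ?_
  have hloc : ∀ᶠ t in 𝓝[>] 0, ∀ i, surfaceEDist M (c t) (γ i t) ≤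
      ENNReal.ofReal ((1 + ε) * ‖c t - γ i t‖) :=
    eventually_all.2 fun i => (hcP.prodMk (hγP i)).eventually (hM.eventually_surfaceEDist_le hP hε)
  have hsmall : ∀ᶠ t in 𝓝[>] (0 : ℝ), ∀ i, t ≤ surfaceDist M P (V i) :=
    eventually_all.2 fun i => (eventually_le_nhds ((hγ i).dist_pos (hne i))).filter_mono
      nhdsWithin_le_nhds
  filter_upwards [hloc, hsmall, hcP.eventually hmin, self_mem_nhdsWithin] with t h1 h2 h3 ht
  have ht0 : (0 : ℝ) < t := ht
  have h4 : ∀ i, surfaceDist M (c t) (V i) ≤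
      (1 + ε) * ‖c t - γ i t‖ + (surfaceDist M P (V i) - t) := fun i => by
    have e1 : surfaceDist M (c t) (γ i t) ≤ (1 + ε) * ‖c t - γ i t‖ :=
      ENNReal.toReal_le_of_le_ofReal (by positivity) (h1 i)
    have e2 := (hγ i).surfaceDist_right ht0.le (h2 i)
    have e3 := (hγ i).1.surfaceEDist_ne_top (hγ i).2.1 t (surfaceDist M P (V i))
    rw [(hγ i).2.2.2] at e3
    have e4 := surfaceDist_triangle (ne_top_of_le_ne_top ENNReal.ofReal_ne_top (h1 i)) e3
    linarith
  have h5 : 0 ≤ ∑ i, w i * ((1 + ε) * ‖c t - γ i t‖ - t) := by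
    have h6 := h3.trans (Finset.sum_le_sum fun i _ => mul_le_mul_of_nonneg_left (h4 i) (hw i))
    rw [← sub_nonneg, ← Finset.sum_sub_distrib] at h6
    refine h6.trans_eq (Finset.sum_congr rfl fun i _ => by ring)
  have h7 : ∑ i, w i * ((1 + ε) * ‖t⁻¹ • (c t - γ i t)‖ - 1) =
      t⁻¹ * ∑ i, w i * ((1 + ε) * ‖c t - γ i t‖ - t) := by
    rw [Finset.mul_sum]
    refine Finset.sum_congr rfl fun i _ => ?_
    rw [norm_smul, Real.norm_of_nonneg (inv_pos.2 ht0).le]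
    field_simp
  rw [h7]
  exact mul_nonneg (inv_pos.2 ht0).le h5

/-- At a local minimum of a weighted sum of intrinsic distances, the weighted unit vectors
along shortest arcs to the given points balance. -/
theorem sum_smul_deriv_eq_zero (hM : IsC2Surface M) (hP : P ∈ M) (hw : ∀ i, 0 ≤ w i)
    (hγ : ∀ i, IsShortestGeodesic M P (V i) (γ i)) (hne : ∀ i, P ≠ V i)
    (hmin : ∀ᶠ X in 𝓝[M] P, ∑ i, w i * surfaceDist M P (V i) ≤ ∑ i, w i * surfaceDist M X (V i)) :
    ∑ i, w i • deriv (γ i) 0 = 0 := by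
  set u : ι → E3 := fun i => deriv (γ i) 0 with hu
  have hu1 : ∀ i, ‖u i‖ = 1 := fun i => (hγ i).2.1 0
  have huT : ∀ i, u i ∈ tangentPlane M P := fun i => by
    have := (hγ i).1.deriv_mem_tangentPlane hM 0
    rwa [(hγ i).2.2.1] at this
  have h1 : ∀ v ∈ tangentPlane M P, 0 ≤ ∑ i, w i * (‖v - u i‖ - 1) := fun v hv => by
    have h2 : Tendsto (fun ε : ℝ => ∑ i, w i * ((1 + ε) * ‖v - u i‖ - 1)) (𝓝[>] 0)
        (𝓝 (∑ i, w i * (‖v - u i‖ - 1))) := by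
      have h3 : Continuous fun ε : ℝ => ∑ i, w i * ((1 + ε) * ‖v - u i‖ - 1) := by fun_prop
      have h4 := (h3.tendsto 0).mono_left (nhdsWithin_le_nhds : 𝓝[>] (0 : ℝ) ≤ 𝓝 0)
      simpa using h4
    refine ge_of_tendsto h2 ?_
    filter_upwards [self_mem_nhdsWithin] with ε hε
    exact first_variation_aux hM hP hw hγ hne hmin hv hε
  set v : E3 := ∑ i, w i • u i with hv
  have hvT : v ∈ tangentPlane M P := Submodule.sum_mem _ fun i _ => Submodule.smul_mem _ _ (huT i)
  set W := ∑ i, w i with hW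
  have hW0 : 0 ≤ W := Finset.sum_nonneg fun i _ => hw i
  -- The test vector is `s • v`, with `v` the sum to be shown zero. By `r - 1 ≤ (r ^ 2 - 1) / 2` the
  -- first-order change is at most `-(s * ‖v‖ ^ 2) + s ^ 2 * ‖v‖ ^ 2 / 2 * W`; since `s * W ≤ 1`,
  -- this is negative unless `v = 0`.
  set s : ℝ := 1 / (W + 1) with hs
  have hs0 : 0 < s := by positivity
  have hsW : s * W ≤ 1 := by
    rw [hs, one_div, inv_mul_le_iff₀ (by positivity)]; linarith
  have h2 : ∀ i, ‖s • v - u i‖ - 1 ≤ -(s * inner ℝ v (u i)) + s ^ 2 * ‖v‖ ^ 2 / 2 := fun i => by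
    have h3 := norm_sub_sq_real (s • v) (u i)
    rw [hu1, norm_smul, inner_smul_left, Real.norm_of_nonneg hs0.le] at h3
    simp only [conj_trivial] at h3
    nlinarith [sq_nonneg (‖s • v - u i‖ - 1)]
  have h3 : ∑ i, w i * (‖s • v - u i‖ - 1) ≤ -(s * ‖v‖ ^ 2) + s ^ 2 * ‖v‖ ^ 2 / 2 * W := by
    refine (Finset.sum_le_sum fun i _ => mul_le_mul_of_nonneg_left (h2 i) (hw i)).trans_eq ?_
    have h4 : ‖v‖ ^ 2 = ∑ i, w i * inner ℝ v (u i) := by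
      rw [← real_inner_self_eq_norm_sq]
      conv_lhs => rw [hv]
      rw [sum_inner]
      refine Finset.sum_congr rfl fun i _ => ?_
      rw [inner_smul_left, real_inner_comm]; simp [hv]
    calc ∑ i, w i * (-(s * inner ℝ v (u i)) + s ^ 2 * ‖v‖ ^ 2 / 2)
        = -(s * ∑ i, w i * inner ℝ v (u i)) + s ^ 2 * ‖v‖ ^ 2 / 2 * ∑ i, w i := by
          rw [Finset.mul_sum, Finset.mul_sum, ← Finset.sum_neg_distrib, ← Finset.sum_add_distrib]
          exact Finset.sum_congr rfl fun i _ => by ring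
      _ = _ := by rw [← h4]
  have h5 := (h1 _ (Submodule.smul_mem _ s hvT)).trans h3
  have h6 : s ^ 2 * ‖v‖ ^ 2 / 2 * W ≤ s * ‖v‖ ^ 2 / 2 := by
    have := mul_le_mul_of_nonneg_left hsW (by positivity : 0 ≤ s * ‖v‖ ^ 2 / 2)
    linarith
  have h7 : s * ‖v‖ ^ 2 ≤ 0 := by linarith
  have h8 : ‖v‖ ^ 2 ≤ 0 := by
    by_contra h
    exact absurd h7 (not_le.2 (mul_pos hs0 (not_le.1 h)))
  exact norm_eq_zero.1 (pow_eq_zero_iff two_ne_zero |>.1 (le_antisymm h8 (sq_nonneg _)))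

end FirstVariation

/-! ### Shortest arcs below the injectivity radius -/

theorem exists_isNormalRadius {M : Set E3} {x : E3} (hx : x ∈ M) {a : ℝ}
    (ha : ENNReal.ofReal a < injectivityRadius M) : ∃ r, a < r ∧ IsNormalRadius M x r := by
  have h1 : ENNReal.ofReal a < injectivityRadiusAt M x := ha.trans_le (iInf₂_le x hx)
  obtain ⟨r, h2⟩ := lt_iSup_iff.1 h1
  obtain ⟨h3, h4⟩ := lt_iSup_iff.1 h2
  exact ⟨r, lt_of_not_ge fun h => not_le.2 h4 (ENNReal.ofReal_le_ofReal h), h3⟩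

theorem surfaceDist_self {M : Set E3} {x : E3} (hx : x ∈ M) : surfaceDist M x x = 0 := by
  have h := surfaceEDist_le_of_lipschitzOnWith (M := M) (γ := fun _ => x) (C := 0) (a := 0) (b := 0)
    le_rfl (LipschitzWith.const x).lipschitzOnWith (fun _ _ => hx)
  rw [ENNReal.coe_zero, zero_mul] at h
  rw [surfaceDist, le_antisymm h zero_le, ENNReal.toReal_zero]

namespace IsGeodesic

variable {M : Set E3} {γ : ℝ → E3}

theorem expEq (h : IsGeodesic M γ) (a : ℝ) : ExpEq M (γ 0) (a • deriv γ 0) (γ a) := by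
  refine ⟨_, h.affine a 0, by simp, ?_, by simp⟩
  rw [h.deriv_affine]; simp

/-- A geodesic shorter than the injectivity radius is a shortest arc. -/
theorem surfaceDist_apply (h : IsGeodesic M γ) (h1 : ∀ t, ‖deriv γ t‖ = 1) {a : ℝ} (ha : 0 ≤ a)
    (hi : ENNReal.ofReal a < injectivityRadius M) : surfaceDist M (γ 0) (γ a) = a := by
  obtain ⟨r, hr, hn⟩ := exists_isNormalRadius (h.2.1 0) hi
  have h2 : ‖a • deriv γ 0‖ = a := by rw [norm_smul, h1, mul_one, Real.norm_of_nonneg ha]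
  rw [hn.1 _ _ (by rwa [h2]) (h.expEq a), h2]

end IsGeodesic

theorem exists_isShortestGeodesic {M : Set E3} (hM : IsC2Surface M) {x y : E3} (hx : x ∈ M)
    (hy : y ∈ M) (hxy : x ≠ y) (hi : ENNReal.ofReal (surfaceDist M x y) < injectivityRadius M) :
    ∃ γ, IsShortestGeodesic M x y γ := by
  obtain ⟨r, hr, hn⟩ := exists_isNormalRadius hx hi
  obtain ⟨v, ⟨hv, hexp⟩, -⟩ := hn.2 y hy hr
  have hd := hn.1 v y hv hexp
  obtain ⟨γ, hγ, h0, hv0, h1⟩ := hexp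
  have hsp : ∀ t, ‖deriv γ t‖ = ‖v‖ := fun t => by rw [hγ.norm_deriv_eq hM, hv0]
  -- A geodesic of speed zero is constant; otherwise it can be rescaled to unit speed.
  have hvpos : ‖v‖ ≠ 0 := fun h => hxy (by
    rw [← h0, ← h1]
    exact is_const_of_deriv_eq_zero hγ.differentiable
      (fun t => norm_eq_zero.1 ((hsp t).trans h)) 0 1)
  refine ⟨fun t => γ (‖v‖⁻¹ * t + 0), hγ.affine _ _, fun t => ?_, by simpa using h0, ?_⟩
  · rw [hγ.deriv_affine, norm_smul, hsp, norm_inv, norm_norm, inv_mul_cancel₀ hvpos]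
  · simp [hd, inv_mul_cancel₀ hvpos, h1]

namespace IsShortestGeodesic

variable {M : Set E3} {x y : E3} {γ σ : ℝ → E3}

/-- Shortest arcs shorter than the injectivity radius are unique. -/
theorem unique (h : IsShortestGeodesic M x y γ) (h' : IsShortestGeodesic M x y σ)
    (hM : IsC2Surface M) (hc : IsCompact M) (hxy : x ≠ y)
    (hi : ENNReal.ofReal (surfaceDist M x y) < injectivityRadius M) : γ = σ := by
  obtain ⟨r, hr, hn⟩ := exists_isNormalRadius h.mem_left hi
  have key : ∀ {τ : ℝ → E3}, IsShortestGeodesic M x y τ →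
      ‖surfaceDist M x y • deriv τ 0‖ < r ∧ ExpEq M x (surfaceDist M x y • deriv τ 0) y := by
    intro τ hτ
    refine ⟨?_, ?_⟩
    · rwa [norm_smul, hτ.2.1, mul_one, Real.norm_of_nonneg (surfaceDist_nonneg M x y)]
    · have := hτ.1.expEq (surfaceDist M x y)
      rwa [hτ.2.2.1, hτ.2.2.2] at this
  have h1 := (hn.2 y h.mem_right hr).unique (key h) (key h')
  exact h.1.eq_of_initial h'.1 hM hc h.2.1 h'.2.1 (h.2.2.1.trans h'.2.2.1.symm)
    (smul_right_injective _ (h.dist_pos hxy).ne' h1)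

/-- A point for which equality holds in the triangle inequality lies on the shortest arc. -/
theorem apply_eq_of_surfaceDist_add (h : IsShortestGeodesic M x y γ) (hM : IsC2Surface M)
    (hc : IsCompact M) (hi : ENNReal.ofReal (surfaceDist M x y) < injectivityRadius M)
    {z : E3} (hz : z ∈ M) (hxz : x ≠ z) (hzy : z ≠ y) (hfin : surfaceEDist M x z ≠ ⊤)
    (hadd : surfaceDist M x z + surfaceDist M z y = surfaceDist M x y) :
    γ (surfaceDist M x z) = z := by
  have hnn := surfaceDist_nonneg M x z
  have hnn' := surfaceDist_nonneg M z y
  have hfin' : surfaceEDist M z y ≠ ⊤ :=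
    surfaceEDist_ne_top_trans (by rwa [surfaceEDist_comm]) h.surfaceEDist_ne_top
  obtain ⟨α, hα⟩ := exists_isShortestGeodesic hM hz h.mem_left hxz.symm
    ((ENNReal.ofReal_le_ofReal (by rw [surfaceDist_comm]; linarith)).trans_lt hi)
  obtain ⟨β, hβ⟩ := exists_isShortestGeodesic hM hz h.mem_right hzy
    ((ENNReal.ofReal_le_ofReal (by linarith)).trans_lt hi)
  -- By the triangle inequality `z` is a local minimum of the sum of the distances to `x` and `y`.
  -- The first variation makes the arcs from `z` to `x` and to `y` leave in opposite directions, so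
  -- they form one smooth geodesic, which uniqueness identifies with `γ`.
  have hsum := sum_smul_deriv_eq_zero (ι := Fin 2) (V := ![x, y]) (w := fun _ => 1) (γ := ![α, β])
    hM hz (fun _ => zero_le_one) (by simpa [Fin.forall_fin_two] using ⟨hα, hβ⟩)
    (by simpa [Fin.forall_fin_two] using ⟨hxz.symm, hzy⟩) (by
      have h1 : ∀ᶠ X in 𝓝[M] z, surfaceEDist M X z ≠ ⊤ :=
        ((hM.tendsto_surfaceEDist hz).eventually (gt_mem_nhds ENNReal.zero_lt_top)).mono
          fun i hi => ne_of_lt hi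
      filter_upwards [h1] with X hX
      have h2 : surfaceEDist M x X ≠ ⊤ :=
        surfaceEDist_ne_top_trans hfin (by rwa [surfaceEDist_comm])
      have h3 := surfaceDist_triangle h2 (surfaceEDist_ne_top_trans hX hfin')
      simp only [Fin.sum_univ_two, Matrix.cons_val_zero, Matrix.cons_val_one, one_mul]
      rw [surfaceDist_comm M z x, surfaceDist_comm M X x, hadd]
      exact h3)
  simp only [Fin.sum_univ_two, Matrix.cons_val_zero, Matrix.cons_val_one, one_smul] at hsum
  have hαβ : β = fun t => α (-1 * t + 0) := by
    refine hβ.1.eq_of_initial (hα.1.affine _ _) hM hc hβ.2.1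
      (norm_deriv_affine hα.1 hα.2.1 (by simp) 0) ?_ ?_
    · simpa [hα.2.2.1] using hβ.2.2.1
    · rw [hα.1.deriv_affine]
      simpa using eq_neg_of_add_eq_zero_right hsum
  have hδ : IsShortestGeodesic M x y (fun t => β (1 * t + -surfaceDist M x z)) := by
    refine ⟨hβ.1.affine _ _, norm_deriv_affine hβ.1 hβ.2.1 (by simp) _, ?_, ?_⟩
    · rw [hαβ]
      have := hα.2.2.2
      rw [surfaceDist_comm] at this
      simpa using this
    · rw [← hadd]
      simpa using hβ.2.2.2
  have hxy : x ≠ y := by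
    rintro rfl
    have := hα.dist_pos hxz.symm
    rw [surfaceDist_self hα.mem_right, surfaceDist_comm M z x] at hadd
    rw [surfaceDist_comm] at this
    linarith
  rw [h.unique hδ hM hc hxy hi]
  simpa using hβ.2.2.1

/-! ### Continuous dependence of shortest arcs on the end point. -/

variable {ι : Type*} {l : Filter ι} {Y : ι → E3} {Γ : ι → ℝ → E3}

/-- By compactness it suffices to identify cluster points of `Γ i s`. Such a point inherits
distances `s` to `x` and `surfaceDist M x y - s` to `y`, so it lies on `γ`. -/
theorem tendsto_apply_of_lt (h : IsShortestGeodesic M x y γ) (hM : IsC2Surface M)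
    (hc : IsCompact M) (hi : ENNReal.ofReal (surfaceDist M x y) < injectivityRadius M)
    (hY : Tendsto Y l (𝓝[M] y)) (hΓ : ∀ᶠ i in l, IsShortestGeodesic M x (Y i) (Γ i)) {s : ℝ}
    (hs : 0 < s) (hsd : s < surfaceDist M x y) :
    Tendsto (fun i => Γ i s) l (𝓝 (γ s)) := by
  refine hc.tendsto_nhds_of_unique_mapClusterPt (hΓ.mono fun i hi => hi.1.2.1 s) ?_
  intro z hz hcl
  obtain ⟨U, hU, hUz⟩ := mapClusterPt_iff_ultrafilter.1 hcl
  have hΓU := hΓ.filter_mono hU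
  have hzM : Tendsto (fun i => Γ i s) U (𝓝[M] z) :=
    tendsto_nhdsWithin_iff.2 ⟨hUz, hΓU.mono fun i hi => hi.1.2.1 s⟩
  have hxc : Tendsto (fun _ : ι => x) (U : Filter ι) (𝓝[M] x) :=
    tendsto_nhdsWithin_iff.2 ⟨tendsto_const_nhds, Eventually.of_forall fun _ => h.mem_left⟩
  have hYU := hY.mono_left hU
  have hD := (hM.tendsto_surfaceDist h.mem_left h.mem_right hxc hYU h.surfaceEDist_ne_top).1
  have hsm := hD.eventually (eventually_gt_nhds hsd)
  have hfin : surfaceEDist M x z ≠ ⊤ := by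
    have h1 := ((hM.tendsto_surfaceEDist hz).comp hzM).eventually (gt_mem_nhds ENNReal.zero_lt_top)
    obtain ⟨i, h2, h3⟩ := (h1.and hΓU).exists
    have h4 := h3.1.surfaceEDist_ne_top h3.2.1 0 s
    rw [h3.2.2.1] at h4
    exact surfaceEDist_ne_top_trans h4 (ne_of_lt h2)
  have e1 : surfaceDist M x z = s := by
    refine tendsto_nhds_unique (hM.tendsto_surfaceDist h.mem_left hz hxc hzM hfin).1 ?_
    refine tendsto_const_nhds.congr' ?_
    filter_upwards [hsm, hΓU] with i h1 h2
    exact (h2.surfaceDist_left hs.le h1.le).symm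
  have hfin' : surfaceEDist M z y ≠ ⊤ :=
    surfaceEDist_ne_top_trans (by rwa [surfaceEDist_comm]) h.surfaceEDist_ne_top
  have e2 : surfaceDist M z y = surfaceDist M x y - s := by
    refine tendsto_nhds_unique (hM.tendsto_surfaceDist hz h.mem_right hzM hYU hfin').1 ?_
    refine (hD.sub_const s).congr' ?_
    filter_upwards [hsm, hΓU] with i h1 h2
    exact (h2.surfaceDist_right hs.le h1.le).symm
  have hxz : x ≠ z := by
    rintro rfl
    rw [surfaceDist_self hz] at e1
    exact hs.ne e1
  have hzy : z ≠ y := by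
    rintro rfl
    rw [surfaceDist_self hz] at e2
    linarith
  have := h.apply_eq_of_surfaceDist_add hM hc hi hz hxz hzy hfin (by rw [e1, e2]; ring)
  rw [e1] at this
  exact this.symm

/-- The initial direction of a shortest arc depends continuously on its end point. -/
theorem tendsto_deriv (h : IsShortestGeodesic M x y γ) (hM : IsC2Surface M)
    (hc : IsCompact M) (hxy : x ≠ y)
    (hi : ENNReal.ofReal (surfaceDist M x y) < injectivityRadius M)
    (hY : Tendsto Y l (𝓝[M] y)) (hΓ : ∀ᶠ i in l, IsShortestGeodesic M x (Y i) (Γ i)) :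
    Tendsto (fun i => deriv (Γ i) 0) l (𝓝 (deriv γ 0)) := by
  obtain ⟨L, hL⟩ := hM.exists_lipschitzOnWith_normalProj hc
  have hL0 : (0 : ℝ) ≤ L := L.2
  have hd := h.dist_pos hxy
  rw [Metric.tendsto_nhds]
  intro ε hε
  -- At time `s` the two Taylor errors together cost at most `2 * L * s ^ 2 ≤ s * (ε / 2)`; the
  -- other half of `ε` pays for the distance of the positions.
  set s : ℝ := min (surfaceDist M x y / 2) (ε / (4 * (L + 1))) with hs
  have hs0 : 0 < s := lt_min (by positivity) (by positivity)
  have hs1 : s < surfaceDist M x y := (min_le_left _ _).trans_lt (by linarith)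
  have hs2 : 2 * L * s ≤ ε / 2 := by
    have h1 : s ≤ ε / (4 * (L + 1)) := min_le_right _ _
    rw [le_div_iff₀ (by positivity)] at h1
    nlinarith
  filter_upwards [hΓ, Metric.tendsto_nhds.1 (h.tendsto_apply_of_lt hM hc hi hY hΓ hs0 hs1)
    (s * (ε / 2)) (by positivity)] with i h1 h2
  rw [dist_eq_norm] at h2 ⊢
  have e1 := h1.1.norm_sub_sub_le hM h1.2.1 hL hs0.le
  have e2 := h.1.norm_sub_sub_le hM h.2.1 hL hs0.le
  rw [h1.2.2.1] at e1
  rw [h.2.2.1] at e2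
  have e3 : s • (deriv (Γ i) 0 - deriv γ 0) = (Γ i s - γ s) +
      ((γ s - x - s • deriv γ 0) - (Γ i s - x - s • deriv (Γ i) 0)) := by
    rw [smul_sub]; abel
  have e4 : s * ‖deriv (Γ i) 0 - deriv γ 0‖ ≤ ‖Γ i s - γ s‖ + (L * s ^ 2 + L * s ^ 2) := by
    calc s * ‖deriv (Γ i) 0 - deriv γ 0‖ = ‖s • (deriv (Γ i) 0 - deriv γ 0)‖ := by
          rw [norm_smul, Real.norm_of_nonneg hs0.le]
      _ ≤ _ := by
          rw [e3]
          exact (norm_add_le _ _).trans (add_le_add le_rfl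
            ((norm_sub_le _ _).trans (add_le_add e2 e1)))
  have e5 := mul_le_mul_of_nonneg_left hs2 hs0.le
  refine lt_of_mul_lt_mul_left ?_ hs0.le
  linarith

/-- The points of a shortest arc, and of its prolongation, depend continuously on its end point. -/
theorem tendsto_apply (h : IsShortestGeodesic M x y γ) (hM : IsC2Surface M)
    (hc : IsCompact M) (hxy : x ≠ y)
    (hi : ENNReal.ofReal (surfaceDist M x y) < injectivityRadius M)
    (hY : Tendsto Y l (𝓝[M] y)) (hΓ : ∀ᶠ i in l, IsShortestGeodesic M x (Y i) (Γ i)) {t : ℝ}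
    (ht : 0 ≤ t) : Tendsto (fun i => Γ i t) l (𝓝 (γ t)) := by
  obtain ⟨L, hL⟩ := hM.exists_lipschitzOnWith_normalProj hc
  have h1 := h.tendsto_deriv hM hc hxy hi hY hΓ
  rw [tendsto_iff_norm_sub_tendsto_zero] at h1 ⊢
  have h2 := h1.mul_const (Real.exp ((1 + 2 * L + 2 * L ^ 2) * t))
  rw [zero_mul] at h2
  refine squeeze_zero' (Eventually.of_forall fun _ => norm_nonneg _) ?_ h2
  filter_upwards [hΓ] with i hi
  exact hi.1.norm_sub_le_exp h.1 hM hi.2.1 h.2.1 hL (hi.2.2.1.trans h.2.2.1.symm) ht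

end IsShortestGeodesic

/-! ### Four balanced directions in cyclic order -/

/-- The expressions are values of the linear form vanishing on the line through `(1, 0)` and `(A₀,
B₀)`. The points `(c, -s)` and `(c, s)` lie strictly on opposite sides because `|(c - 1) * B₀| ≤ 1 -
c < s < s * (1 - A₀)`, and the line meets the unit circle in only those two points. -/
theorem chord_coordinates {c s A₀ B₀ A B : ℝ} (hc : 0 < c) (hs : 0 < s) (hcs : c ^ 2 + s ^ 2 = 1)
    (h0 : A₀ ^ 2 + B₀ ^ 2 = 1) (hA₀ : A₀ < 0) (h : A ^ 2 + B ^ 2 = 1) :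
    (c - 1) * B₀ - s * (1 - A₀) < 0 ∧ 0 < (c - 1) * B₀ + s * (1 - A₀) ∧
      ((A - 1) * B₀ + B * (1 - A₀) = 0 → (A = 1 ∧ B = 0) ∨ (A = A₀ ∧ B = B₀)) := by
  have hc1 : c < 1 := by nlinarith
  have hcs1 : 1 < c + s := by nlinarith
  have hB1 : B₀ ≤ 1 := by nlinarith
  have hB2 : -1 ≤ B₀ := by nlinarith
  refine ⟨?_, ?_, fun hl => ?_⟩
  · nlinarith [mul_nonneg (sub_nonneg.2 hc1.le) (by linarith : 0 ≤ 1 + B₀)]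
  · nlinarith [mul_nonneg (sub_nonneg.2 hc1.le) (by linarith : 0 ≤ 1 - B₀)]
  · have hm : 0 < 1 - A₀ := by linarith
    have h1 : B * (1 - A₀) = (1 - A) * B₀ := by linarith
    have h2 : (1 - A₀) * ((1 - A) * (2 * (A - A₀))) = 0 := by
      have h3 : (B * (1 - A₀)) ^ 2 = ((1 - A) * B₀) ^ 2 := by rw [h1]
      have h4 : B ^ 2 = 1 - A ^ 2 := by linarith
      have h5 : B₀ ^ 2 = 1 - A₀ ^ 2 := by linarith
      rw [mul_pow, mul_pow, h4, h5] at h3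
      linear_combination h3
    rcases mul_eq_zero.1 ((mul_eq_zero.1 h2).resolve_left hm.ne') with h3 | h3
    · left
      refine ⟨by linarith, ?_⟩
      rw [h3, zero_mul] at h1
      exact (mul_eq_zero.1 h1).resolve_right hm.ne'
    · right
      have h4 : A = A₀ := by linarith
      refine ⟨h4, ?_⟩
      rw [h4, mul_comm] at h1
      exact mul_left_cancel₀ hm.ne' h1

section Plane

variable {E : Type*} [NormedAddCommGroup E] [InnerProductSpace ℝ E]

theorem eq_add_of_orthonormal_pair {T : Submodule ℝ E} (hT : Module.finrank ℝ T = 2) {q f : E}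
    (hq : q ∈ T) (hf : f ∈ T) (hq1 : ‖q‖ = 1) (hf1 : ‖f‖ = 1) (hqf : inner ℝ q f = 0) {x : E}
    (hx : x ∈ T) : x = inner ℝ q x • q + inner ℝ f x • f := by
  have hon : Orthonormal ℝ ![q, f] := by
    refine ⟨by simp [Fin.forall_fin_two, hq1, hf1], ?_⟩
    intro i j hij
    fin_cases i <;> fin_cases j <;> simp_all [real_inner_comm]
  have : FiniteDimensional ℝ T := Module.finite_of_finrank_pos (by omega)
  have hsp : Submodule.span ℝ (range ![q, f]) = T := by
    refine Submodule.eq_of_le_of_finrank_eq (Submodule.span_le.2 ?_) ?_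
    · rintro _ ⟨i, rfl⟩
      fin_cases i <;> simp [hq, hf]
    · rw [finrank_span_eq_card hon.linearIndependent, hT]; rfl
  rw [← hsp] at hx
  simp only [Matrix.range_cons, Matrix.range_empty, union_empty, singleton_union] at hx
  obtain ⟨a, b, rfl⟩ := Submodule.mem_span_pair.1 hx
  simp [inner_add_right, inner_smul_right, hq1, hf1, hqf, real_inner_comm q f]

/-- A connected subset of the unit circle containing `a` and `b`, but missing a point of the
half circle opposite to the midpoint `q` of `a` and `b`, contains `q`. -/
theorem midpoint_direction_mem {T : Submodule ℝ E} (hT : Module.finrank ℝ T = 2) {a b z : E}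
    {S : Set E} (hS : IsPreconnected S) (hST : ∀ x ∈ S, x ∈ T ∧ ‖x‖ = 1) (ha : a ∈ S) (hb : b ∈ S)
    (hab : a ≠ b) (hab' : a + b ≠ 0) (hz : z ∈ T) (hz1 : ‖z‖ = 1) (hzS : z ∉ S)
    (hzab : inner ℝ (a + b) z < 0) : ‖a + b‖⁻¹ • (a + b) ∈ S := by
  obtain ⟨haT, ha1⟩ := hST a ha
  obtain ⟨hbT, hb1⟩ := hST b hb
  have hp : 0 < ‖a + b‖ := norm_pos_iff.2 hab'
  have hm : 0 < ‖a - b‖ := norm_pos_iff.2 (sub_ne_zero.2 hab)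
  set q := ‖a + b‖⁻¹ • (a + b) with hq
  set f := ‖a - b‖⁻¹ • (a - b) with hf
  have hq1 : ‖q‖ = 1 := norm_smul_inv_norm (𝕜 := ℝ) hab'
  have hf1 : ‖f‖ = 1 := norm_smul_inv_norm (𝕜 := ℝ) (sub_ne_zero.2 hab)
  have horth : inner ℝ (a + b) (a - b) = 0 := by
    rw [real_inner_add_sub_eq_zero_iff, ha1, hb1]
  have hqf : inner ℝ q f = 0 := by rw [hq, hf, inner_smul_left, inner_smul_right, horth]; simp
  have hqT : q ∈ T := T.smul_mem _ (T.add_mem haT hbT)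
  have hfT : f ∈ T := T.smul_mem _ (T.sub_mem haT hbT)
  have hcoord : ∀ {x}, x ∈ T → x = inner ℝ q x • q + inner ℝ f x • f := fun hx =>
    eq_add_of_orthonormal_pair hT hqT hfT hq1 hf1 hqf hx
  have hsq : ∀ {x}, x ∈ T → ‖x‖ = 1 → inner ℝ q x ^ 2 + inner ℝ f x ^ 2 = 1 := fun {x} hx hx1 => by
    have h1 : ∀ α β : ℝ, ‖α • q + β • f‖ ^ 2 = α ^ 2 + β ^ 2 := fun α β => by
      rw [norm_add_sq_real, norm_smul α q, norm_smul β f, real_inner_smul_left, real_inner_smul_right, hqf,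
        hq1, hf1]
      simp
    rw [← h1, ← hcoord hx, hx1, one_pow]
  have hqa : inner ℝ q a = ‖a + b‖ / 2 := by
    have h1 : inner ℝ (a + b) a = ‖a + b‖ ^ 2 / 2 := by
      rw [norm_add_sq_real, inner_add_left, real_inner_self_eq_norm_sq, ha1, hb1,
        real_inner_comm]; ring
    rw [hq, inner_smul_left, h1]; simp only [conj_trivial]; field_simp
  have hqb : inner ℝ q b = ‖a + b‖ / 2 := by
    have h1 : inner ℝ (a + b) b = ‖a + b‖ ^ 2 / 2 := by
      rw [norm_add_sq_real, inner_add_left, real_inner_self_eq_norm_sq, ha1, hb1]; ring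
    rw [hq, inner_smul_left, h1]; simp only [conj_trivial]; field_simp
  have hfa : inner ℝ f a = ‖a - b‖ / 2 := by
    have h1 : inner ℝ (a - b) a = ‖a - b‖ ^ 2 / 2 := by
      rw [norm_sub_sq_real, inner_sub_left, real_inner_self_eq_norm_sq, ha1, hb1,
        real_inner_comm]; ring
    rw [hf, inner_smul_left, h1]; simp only [conj_trivial]; field_simp
  have hfb : inner ℝ f b = -(‖a - b‖ / 2) := by
    have h1 : inner ℝ (a - b) b = -(‖a - b‖ ^ 2 / 2) := by
      rw [norm_sub_sq_real, inner_sub_left, real_inner_self_eq_norm_sq, ha1, hb1]; ring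
    rw [hf, inner_smul_left, h1]; simp only [conj_trivial]; field_simp
  have hcs : (‖a + b‖ / 2) ^ 2 + (‖a - b‖ / 2) ^ 2 = 1 := by
    rw [← hqa, ← hfa]; exact hsq haT ha1
  have hz0 : inner ℝ q z < 0 := by
    rw [hq, inner_smul_left]
    simp only [conj_trivial]
    exact mul_neg_of_pos_of_neg (inv_pos.2 hp) hzab
  have key := fun x (hx : x ∈ S) => chord_coordinates (half_pos hp) (half_pos hm) hcs (hsq hz hz1)
    hz0 (hsq (hST x hx).1 (hST x hx).2)
  set ℓ : E → ℝ := fun x => (inner ℝ q x - 1) * inner ℝ f z + inner ℝ f x * (1 - inner ℝ q z) with hℓ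
  have hℓc : Continuous ℓ := by fun_prop
  have h1 : ℓ b < 0 := by
    have := (key b hb).1
    simp only [hℓ, hqb, hfb]; linarith
  have h2 : 0 < ℓ a := by
    have := (key a ha).2.1
    simp only [hℓ, hqa, hfa]; linarith
  -- `ℓ` vanishes on the chord from `q` to `z` and separates `a` from `b`, so `S` meets the chord
  -- line on the circle: at `q`, or at the excluded point `z`.
  obtain ⟨x, hx, hx0⟩ := hS.intermediate_value hb ha hℓc.continuousOn ⟨h1.le, h2.le⟩
  have hxT := (hST x hx).1
  rcases (key x hx).2.2 hx0 with ⟨h3, h4⟩ | ⟨h3, h4⟩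
  · have h5 := hcoord hxT
    rw [h3, h4, one_smul, zero_smul, add_zero] at h5
    rwa [← h5]
  · have h5 := hcoord hxT
    rw [h3, h4, ← hcoord hz] at h5
    exact absurd (h5 ▸ hx) hzS

/-- Four balanced unit vectors with alternating weights, in cyclic order, are pairwise opposite.
The cyclic order is expressed by two connected subsets of the unit circle joining `u₁` to `u₃`. -/
theorem add_eq_zero_of_balanced {T : Submodule ℝ E} (hT : Module.finrank ℝ T = 2)
    {u₀ u₁ u₂ u₃ : E} {S S' : Set E} (hS : IsPreconnected S) (hS' : IsPreconnected S')
    (hST : ∀ x ∈ S, x ∈ T ∧ ‖x‖ = 1) (hST' : ∀ x ∈ S', x ∈ T ∧ ‖x‖ = 1)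
    (h1 : u₁ ∈ S) (h2 : u₂ ∈ S) (h3 : u₃ ∈ S) (h0' : u₀ ∈ S') (h1' : u₁ ∈ S') (h3' : u₃ ∈ S')
    (h0 : u₀ ∉ S) (h2' : u₂ ∉ S') (hSS' : S ∩ S' ⊆ {u₁, u₃}) (h13 : u₁ ≠ u₃) {a b : ℝ}
    (ha : 0 < a) (hb : 0 < b) (hbal : a • (u₀ + u₂) + b • (u₁ + u₃) = 0) : u₀ + u₂ = 0 := by
  by_contra hne
  obtain ⟨h0T, h01⟩ := hST' u₀ h0'
  obtain ⟨h2T, h21⟩ := hST u₂ h2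
  have h11 := (hST u₁ h1).2
  have h31 := (hST u₃ h3).2
  have hb' : b • (u₁ + u₃) = -(a • (u₀ + u₂)) := eq_neg_of_add_eq_zero_right hbal
  have hne' : u₁ + u₃ ≠ 0 := by
    intro h
    rw [h, smul_zero, eq_comm, neg_eq_zero] at hb'
    exact hne ((smul_eq_zero.1 hb').resolve_left ha.ne')
  have hn : 0 < ‖u₀ + u₂‖ ^ 2 := by
    have := norm_pos_iff.2 hne
    positivity
  -- Both `u₀` and `u₂` have this inner product with their sum, so by balance both lie in the half
  -- circle opposite to `u₁ + u₃`.
  have hneg : ∀ z, inner ℝ (u₀ + u₂) z = ‖u₀ + u₂‖ ^ 2 / 2 → inner ℝ (u₁ + u₃) z < 0 := by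
    intro z hz
    have e1 : b * inner ℝ (u₁ + u₃) z = -(a * inner ℝ (u₀ + u₂) z) := by
      have := congrArg (fun v => inner ℝ v z) hb'
      simpa only [inner_smul_left, inner_neg_left, conj_trivial] using this
    rw [hz] at e1
    have e2 : b * inner ℝ (u₁ + u₃) z < 0 := by
      rw [e1]
      have := mul_pos ha (half_pos hn)
      linarith
    exact (pos_iff_neg_of_mul_neg e2).1 hb
  have hq := midpoint_direction_mem hT hS hST h1 h3 h13 hne' h0T h01 h0 (hneg _ (by
    rw [norm_add_sq_real, inner_add_left, real_inner_self_eq_norm_sq, h01, h21,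
      real_inner_comm]; ring))
  have hq' := midpoint_direction_mem hT hS' hST' h1' h3' h13 hne' h2T h21 h2' (hneg _ (by
    rw [norm_add_sq_real, inner_add_left, real_inner_self_eq_norm_sq, h01, h21]; ring))
  have hinner : inner ℝ (‖u₁ + u₃‖⁻¹ • (u₁ + u₃)) (u₁ - u₃) = 0 := by
    rw [inner_smul_left, real_inner_add_sub_eq_zero_iff u₁ u₃ |>.2 (by rw [h11, h31]), mul_zero]
  have hsub : ‖u₁ - u₃‖ ^ 2 = 2 - 2 * inner ℝ u₁ u₃ := by
    rw [norm_sub_sq_real, h11, h31]; ring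
  have hpos : 0 < ‖u₁ - u₃‖ ^ 2 := by
    have := norm_pos_iff.2 (sub_ne_zero.2 h13)
    positivity
  -- The midpoint direction is orthogonal to `u₁ - u₃`, whereas neither `u₁` nor `u₃` is.
  rcases hSS' ⟨hq, hq'⟩ with h | h
  · rw [h, inner_sub_right, real_inner_self_eq_norm_sq, h11] at hinner
    linarith
  · rw [mem_singleton_iff.1 h, inner_sub_right, real_inner_self_eq_norm_sq, h31,
      real_inner_comm] at hinner
    linarith

end Plane

/-! ### Convex domains seen from an interior point -/

section ConvexDomain

variable {M Q : Set E3} {P : E3}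

theorem IsSurfaceConvex.surfaceEDist_ne_top (hQ : IsSurfaceConvex M Q) {x y : E3} (hx : x ∈ Q)
    (hy : y ∈ Q) : surfaceEDist M x y ≠ ⊤ :=
  (hQ x hx y hy).1.elim fun _ h => h.surfaceEDist_ne_top

/-- The points strictly between an interior point and any point of a convex domain are interior. -/
theorem IsSurfaceConvex.apply_mem_surfaceInterior (hQ : IsSurfaceConvex M Q)
    (hM : IsC2Surface M) (hc : IsCompact M) (hP : P ∈ surfaceInterior M Q) {Y : E3} (hY : Y ∈ Q)
    (hi : ENNReal.ofReal (surfaceDist M P Y) < injectivityRadius M) {γ : ℝ → E3}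
    (hγ : IsShortestGeodesic M P Y γ) {a : ℝ} (ha : 0 < a) (hab : a < surfaceDist M P Y) :
    γ a ∈ surfaceInterior M Q := by
  set b := surfaceDist M P Y with hb
  set σ : ℝ → E3 := fun t => γ (-1 * t + b) with hσ
  have hσPY : IsShortestGeodesic M Y P σ := hγ.reverse
  have hbb : surfaceDist M Y P = b := surfaceDist_comm M Y P
  have hσa : σ (b - a) = γ a := by simp only [hσ]; congr 1; ring
  have hσX : IsShortestGeodesic M Y (γ a) σ := by
    have := hσPY.initial (a := b - a) (by linarith) (by linarith)
    rwa [hσa] at this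
  have hd : surfaceDist M Y (γ a) = b - a := by
    rw [← hσa]
    exact hσPY.surfaceDist_left (by linarith) (by linarith)
  have hYX : Y ≠ γ a := by
    intro h
    rw [← h, surfaceDist_self hγ.mem_right] at hd
    linarith
  have hXM := hγ.1.2.1 a
  refine ⟨(hQ P hP.1 Y hY).2 γ hγ ⟨a, ⟨ha.le, hab.le⟩, rfl⟩, ?_⟩
  have hlt : ∀ᶠ Z in 𝓝[M] (γ a), surfaceDist M Y Z < b := by
    refine ((hM.tendsto_surfaceDist hγ.mem_right hXM (tendsto_nhdsWithin_iff.2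
      ⟨tendsto_const_nhds, Eventually.of_forall fun _ => hγ.mem_right⟩) tendsto_id
      hσX.surfaceEDist_ne_top).1).eventually (gt_mem_nhds ?_)
    rw [hd]; linarith
  have hne : ∀ᶠ Z in 𝓝[M] (γ a), Z ≠ Y :=
    (eventually_ne_nhds hYX.symm).filter_mono nhdsWithin_le_nhds
  set Γ : E3 → ℝ → E3 := fun Z => Classical.epsilon (IsShortestGeodesic M Y Z) with hΓ
  have hΓs : ∀ᶠ Z in 𝓝[M] (γ a), IsShortestGeodesic M Y Z (Γ Z) := by
    filter_upwards [hlt, hne, self_mem_nhdsWithin] with Z h1 h2 h3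
    exact Classical.epsilon_spec (exists_isShortestGeodesic hM hγ.mem_right h3 h2.symm
      ((ENNReal.ofReal_le_ofReal h1.le).trans_lt hi))
  -- Shoot from `Y` through `Z` near `γ a` and continue to length `b`. The end point is near `P`,
  -- hence in `Q`; as `b` is below the injectivity radius the whole arc is shortest, so convexity
  -- puts `Z` in `Q`.
  have hlim := hσX.tendsto_apply (Y := id) (l := 𝓝[M] (γ a)) hM hc hYX
    ((ENNReal.ofReal_le_ofReal (by rw [hd]; linarith)).trans_lt hi) tendsto_id hΓs
    (surfaceDist_nonneg M P Y)
  have hσb : σ b = P := by rw [← hbb]; exact hσPY.2.2.2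
  rw [← hb, hσb] at hlim
  have hlim' : Tendsto (fun Z => Γ Z b) (𝓝[M] (γ a)) (𝓝[M] P) :=
    tendsto_nhdsWithin_iff.2 ⟨hlim, hΓs.mono fun Z hZ => hZ.1.2.1 b⟩
  filter_upwards [hΓs, hlt, hlim'.eventually hP.2] with Z h1 h2 h3
  have h6 : surfaceDist M Y (Γ Z b) = b := by
    have := h1.1.surfaceDist_apply h1.2.1 (surfaceDist_nonneg M P Y) hi
    rwa [h1.2.2.1, ← hb] at this
  have h4 : IsShortestGeodesic M Y (Γ Z b) (Γ Z) := ⟨h1.1, h1.2.1, h1.2.2.1, by rw [h6]⟩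
  have h7 := (hQ Y hY _ h3).2 _ h4
  refine h7 ⟨surfaceDist M Y Z, ⟨surfaceDist_nonneg M Y Z, ?_⟩, h1.2.2.2⟩
  rw [h6]; exact h2.le

/-- Boundary points of a convex domain are mapped continuously and injectively to their
directions at an interior point. -/
theorem IsSurfaceConvex.exists_direction_map (hQ : IsSurfaceConvex M Q) (hM : IsC2Surface M)
    (hc : IsCompact M) (hP : P ∈ surfaceInterior M Q) {J : Set E3} (hJ : J ⊆ Q \ surfaceInterior M Q)
    (hi : ∀ Y ∈ J, ENNReal.ofReal (surfaceDist M P Y) < injectivityRadius M) :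
    ∃ φ : E3 → E3, ContinuousOn φ J ∧ InjOn φ J ∧
      (∀ Y ∈ J, φ Y ∈ tangentPlane M P ∧ ‖φ Y‖ = 1) ∧
      ∀ Y ∈ J, ∀ γ, IsShortestGeodesic M P Y γ → deriv γ 0 = φ Y := by
  set Γ : E3 → ℝ → E3 := fun Y => Classical.epsilon (IsShortestGeodesic M P Y)
  have hΓ : ∀ Y ∈ J, IsShortestGeodesic M P Y (Γ Y) := fun Y hY =>
    Classical.epsilon_spec (hQ P hP.1 Y (hJ hY).1).1
  have hne : ∀ Y ∈ J, P ≠ Y := by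
    rintro Y hY rfl
    exact (hJ hY).2 hP
  refine ⟨fun Y => deriv (Γ Y) 0, ?_, ?_, ?_, ?_⟩
  · intro Y hY
    refine (hΓ Y hY).tendsto_deriv (Y := id) hM hc (hne Y hY) (hi Y hY) ?_
      (eventually_mem_nhdsWithin.mono hΓ)
    exact tendsto_nhdsWithin_iff.2 ⟨tendsto_id.mono_left nhdsWithin_le_nhds,
      eventually_mem_nhdsWithin.mono fun Z hZ => (hΓ Z hZ).mem_right⟩
  · have key : ∀ X ∈ J, ∀ Y ∈ J, Γ X = Γ Y → ¬ surfaceDist M P X < surfaceDist M P Y := by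
      intro X hX Y hY h hlt
      have h1 := hQ.apply_mem_surfaceInterior hM hc hP (hJ hY).1 (hi Y hY) (hΓ Y hY)
        ((hΓ X hX).dist_pos (hne X hX)) hlt
      rw [← h, (hΓ X hX).2.2.2] at h1
      exact (hJ hX).2 h1
    intro X hX Y hY h
    have h1 : Γ X = Γ Y := (hΓ X hX).1.eq_of_initial (hΓ Y hY).1 hM hc (hΓ X hX).2.1
      (hΓ Y hY).2.1 ((hΓ X hX).2.2.1.trans (hΓ Y hY).2.2.1.symm) h
    have h2 : surfaceDist M P X = surfaceDist M P Y :=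
      le_antisymm (not_lt.1 (key Y hY X hX h1.symm)) (not_lt.1 (key X hX Y hY h1))
    rw [← (hΓ X hX).2.2.2, ← (hΓ Y hY).2.2.2, h1, h2]
  · intro Y hY
    refine ⟨?_, (hΓ Y hY).2.1 0⟩
    have := (hΓ Y hY).1.deriv_mem_tangentPlane hM 0
    rwa [(hΓ Y hY).2.2.1] at this
  · intro Y hY γ hγ
    rw [hγ.unique (hΓ Y hY) hM hc (hne Y hY) (hi Y hY)]

/-- A point with a small weighted sum of distances to the vertices of a quadrilateral `ABCD` is
within half of the perimeter of each point of the side `AB`. -/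
theorem two_mul_surfaceDist_le_perimeter (hfin : ∀ x ∈ Q, ∀ y ∈ Q, surfaceEDist M x y ≠ ⊤)
    {A B C D Y : E3} (hP : P ∈ Q) (hA : A ∈ Q) (hB : B ∈ Q) (hC : C ∈ Q) (hD : D ∈ Q) (hY : Y ∈ Q)
    {w k : ℝ} (hw : 0 < w) (hk : 0 < k)
    (hmin : w * (surfaceDist M P A + surfaceDist M P C) +
        k * (surfaceDist M P B + surfaceDist M P D) ≤
      w * surfaceDist M C A + k * (surfaceDist M C B + surfaceDist M C D))
    (hAB : surfaceDist M A Y + surfaceDist M Y B = surfaceDist M A B) :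
    2 * surfaceDist M P Y ≤ surfaceDist M A B + surfaceDist M B C + surfaceDist M C D +
      surfaceDist M D A := by
  have tri : ∀ x ∈ Q, ∀ y ∈ Q, ∀ z ∈ Q,
      surfaceDist M x z ≤ surfaceDist M x y + surfaceDist M y z := fun x hx y hy z hz =>
    surfaceDist_triangle (hfin x hx y hy) (hfin y hy z hz)
  have t1 := tri P hP A hA Y hY
  have t2 := tri P hP B hB Y hY
  have t3 := tri C hC D hD A hA
  have t4 := tri P hP C hC B hB
  have t5 := tri P hP D hD A hA
  have t6 := tri C hC P hP D hD
  rw [surfaceDist_comm M B Y] at t2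
  rw [surfaceDist_comm M C B] at t4 hmin
  rw [surfaceDist_comm M C P] at t6
  have e3 := mul_le_mul_of_nonneg_left t3 hw.le
  -- With `t1`, `t2` and `hAB` this is all that is needed. `hmin` compares `P` with the vertex `C`;
  -- its unequal weights are levelled up to the larger one by `t4` or `t5`, multiplied by the
  -- difference of the weights.
  have key : surfaceDist M P A + surfaceDist M P B ≤
      surfaceDist M B C + surfaceDist M C D + surfaceDist M D A := by
    rcases le_total k w with h | h
    · have e4 := mul_le_mul_of_nonneg_left t4 (sub_nonneg.2 h)
      have e6 := mul_le_mul_of_nonneg_left t6 hk.le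
      refine le_of_mul_le_mul_left ?_ hw
      linarith
    · have e5 := mul_le_mul_of_nonneg_left t5 (sub_nonneg.2 h)
      have e6 := mul_le_mul_of_nonneg_left t6 hw.le
      refine le_of_mul_le_mul_left ?_ hk
      linarith
  linarith

end ConvexDomain

/-! ### Directions from a Fermat-Torricelli point to the vertices -/

theorem isParallelogram_of_opposite {a b : E3} (h1 : ‖a‖ = 1) (h2 : ‖b‖ = 1) (hab : a ≠ b)
    (hab' : a ≠ -b) {s t : ℝ} (hs : 0 < s) (ht : 0 < t) :
    IsParallelogram (s • a) (t • b) (s • -a) (t • -b) := by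
  refine ⟨by rw [smul_neg, smul_neg]; abel, ?_⟩
  have hlin : LinearIndependent ℝ ![a, b] := by
    rw [LinearIndependent.pair_iff' (norm_ne_zero_iff.1 (by rw [h1]; exact one_ne_zero))]
    intro c hc
    have hc1 : |c| = 1 := by
      have := congrArg norm hc
      rwa [norm_smul, h1, h2, mul_one, Real.norm_eq_abs] at this
    rcases (abs_eq zero_le_one).1 hc1 with h | h
    · rw [h, one_smul] at hc
      exact hab hc
    · rw [h, neg_one_smul] at hc
      exact hab' (by rw [← hc, neg_neg])
  rw [affineIndependent_iff_linearIndependent_vsub ℝ _ (0 : Fin 3),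
    ← linearIndependent_equiv (finSuccAboveEquiv (0 : Fin 3))]
  rw [LinearIndependent.pair_iff] at hlin
  rw [show (fun i : { x : Fin 3 // x ≠ 0 } =>
      (![s • a, t • b, t • -b] i -ᵥ ![s • a, t • b, t • -b] 0 : E3)) ∘
      (finSuccAboveEquiv (0 : Fin 3)) = ![t • b - s • a, t • -b - s • a] by
    ext i : 1
    fin_cases i <;> rfl, LinearIndependent.pair_iff]
  intro x y hxy
  have h3 := hlin (-(x + y) * s) ((x - y) * t) (by
    rw [← hxy]; module)
  have h4 := (mul_eq_zero.1 h3.1).resolve_right hs.ne'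
  have h5 := (mul_eq_zero.1 h3.2).resolve_right ht.ne'
  constructor <;> linarith

/-- The boundary points of the quadrilateral are closer to the weighted Fermat-Torricelli point
than the injectivity radius. -/
theorem IsConvexQuadrilateral.surfaceDist_lt_injectivityRadius {M : Set E3} {V : Fin 4 → E3}
    {Q : Set E3} (hQ : IsConvexQuadrilateral M Q V)
    (hper : ENNReal.ofReal (∑ i, surfaceDist M (V i) (V (i + 1))) < 2 * injectivityRadius M)
    {w : Fin 4 → ℝ} (hw : ∀ i, 0 < w i) {P : E3} (hP : IsFermatTorricelli M V w P)
    (hPQ : P ∈ surfaceInterior M Q) (hAC : w 0 = w 2) (hBD : w 1 = w 3) :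
    ∀ Y ∈ Q \ surfaceInterior M Q, ENNReal.ofReal (surfaceDist M P Y) < injectivityRadius M := by
  obtain ⟨-, -, hconv, -, σ, hσ, -, -, hbd⟩ := hQ
  set J := Q \ surfaceInterior M Q
  have hfin : ∀ x ∈ Q, ∀ y ∈ Q, surfaceEDist M x y ≠ ⊤ := fun x hx y hy =>
    hconv.surfaceEDist_ne_top hx hy
  have hVQ : ∀ i, V i ∈ Q := fun i =>
    ((hbd ▸ mem_iUnion.2 ⟨i, (hσ i).mem_arcSet_left⟩ : V i ∈ J)).1
  have hVM : ∀ i, V i ∈ M := fun i => (hσ i).mem_left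
  have hself : ∀ i, surfaceDist M (V i) (V i) = 0 := fun i => surfaceDist_self (hVM i)
  have hmin : ∀ j, _ := fun j => hP.2 (V j) (hVM j)
  simp only [Fin.sum_univ_four, ← hAC, ← hBD] at hmin
  rw [Fin.sum_univ_four] at hper
  have hhalf : ∀ Y ∈ J, 2 * surfaceDist M P Y ≤ surfaceDist M (V 0) (V (0 + 1)) +
      surfaceDist M (V 1) (V (1 + 1)) + surfaceDist M (V 2) (V (2 + 1)) +
      surfaceDist M (V 3) (V (3 + 1)) := by
    intro Y hY
    obtain ⟨i, hi⟩ := mem_iUnion.1 (hbd ▸ hY : Y ∈ ⋃ i, arcSet M (V i) (V (i + 1)) (σ i))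
    have hadd := (hσ i).surfaceDist_add hi
    have m0 := hmin 0
    have m1 := hmin 1
    have m2 := hmin 2
    have m3 := hmin 3
    rw [hself] at m0 m1 m2 m3
    -- For the side from `V i` to `V (i + 1)` the comparison vertex is `V (i + 2)`; each cyclic
    -- shift exchanges the two weights.
    fin_cases i
    · exact (two_mul_surfaceDist_le_perimeter hfin hPQ.1 (hVQ 0) (hVQ 1) (hVQ 2) (hVQ 3) hY.1
        (hw 0) (hw 1) (by linarith) hadd).trans_eq rfl
    · refine (two_mul_surfaceDist_le_perimeter hfin hPQ.1 (hVQ 1) (hVQ 2) (hVQ 3) (hVQ 0) hY.1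
        (hw 1) (hw 0) (by linarith) hadd).trans_eq ?_
      change surfaceDist M (V 1) (V 2) + surfaceDist M (V 2) (V 3) + surfaceDist M (V 3) (V 0) +
        surfaceDist M (V 0) (V 1) = surfaceDist M (V 0) (V 1) + surfaceDist M (V 1) (V 2) +
        surfaceDist M (V 2) (V 3) + surfaceDist M (V 3) (V 0)
      ring
    · refine (two_mul_surfaceDist_le_perimeter hfin hPQ.1 (hVQ 2) (hVQ 3) (hVQ 0) (hVQ 1) hY.1
        (hw 0) (hw 1) (by linarith) hadd).trans_eq ?_
      change surfaceDist M (V 2) (V 3) + surfaceDist M (V 3) (V 0) + surfaceDist M (V 0) (V 1) +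
        surfaceDist M (V 1) (V 2) = surfaceDist M (V 0) (V 1) + surfaceDist M (V 1) (V 2) +
        surfaceDist M (V 2) (V 3) + surfaceDist M (V 3) (V 0)
      ring
    · refine (two_mul_surfaceDist_le_perimeter hfin hPQ.1 (hVQ 3) (hVQ 0) (hVQ 1) (hVQ 2) hY.1
        (hw 1) (hw 0) (by linarith) hadd).trans_eq ?_
      change surfaceDist M (V 3) (V 0) + surfaceDist M (V 0) (V 1) + surfaceDist M (V 1) (V 2) +
        surfaceDist M (V 2) (V 3) = surfaceDist M (V 0) (V 1) + surfaceDist M (V 1) (V 2) +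
        surfaceDist M (V 2) (V 3) + surfaceDist M (V 3) (V 0)
      ring
  intro Y hY
  have h1 := (ENNReal.ofReal_le_ofReal (hhalf Y hY)).trans_lt hper
  rw [ENNReal.ofReal_mul zero_le_two, ENNReal.ofReal_ofNat] at h1
  exact lt_of_not_ge fun h => not_le.2 h1 (mul_le_mul_right h 2)

/-- The directions from an interior weighted Fermat-Torricelli point to the vertices of a convex
quadrilateral with equal weights at opposite vertices are pairwise opposite. -/
theorem exists_opposite_directions {M : Set E3} (hM : IsC2Surface M) (hc : IsCompact M)
    {V : Fin 4 → E3} {Q : Set E3} (hQ : IsConvexQuadrilateral M Q V)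
    (hper : ENNReal.ofReal (∑ i, surfaceDist M (V i) (V (i + 1))) < 2 * injectivityRadius M)
    {w : Fin 4 → ℝ} (hw : ∀ i, 0 < w i) {P : E3} (hP : IsFermatTorricelli M V w P)
    (hPQ : P ∈ surfaceInterior M Q) (hAC : w 0 = w 2) (hBD : w 1 = w 3) :
    ∃ u : Fin 4 → E3, (∀ i, ‖u i‖ = 1) ∧ u 2 = -u 0 ∧ u 3 = -u 1 ∧ u 0 ≠ u 1 ∧ u 0 ≠ -u 1 ∧
      ∀ i, ∀ γ, IsShortestGeodesic M P (V i) γ → deriv γ 0 = u i := by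
  have hinjr := hQ.surfaceDist_lt_injectivityRadius hper hw hP hPQ hAC hBD
  obtain ⟨-, -, hconv, hinj, σ, hσ, hadj, hopp, hbd⟩ := hQ
  set J := Q \ surfaceInterior M Q
  have hside : ∀ i, arcSet M (V i) (V (i + 1)) (σ i) ⊆ J := fun i => by
    rw [hbd]; exact subset_iUnion (fun i => arcSet M (V i) (V (i + 1)) (σ i)) i
  have hVJ : ∀ i, V i ∈ J := fun i => hside i (hσ i).mem_arcSet_left
  have hVQ : ∀ i, V i ∈ Q := fun i => (hVJ i).1
  obtain ⟨φ, hφc, hφi, hφT, hφ⟩ := hconv.exists_direction_map hM hc hPQ subset_rfl hinjr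
  have hexγ : ∀ i, ∃ γ, IsShortestGeodesic M P (V i) γ := fun i => (hconv P hPQ.1 _ (hVQ i)).1
  choose γ hγ using hexγ
  have hPV : ∀ i, P ≠ V i := fun i h => (hVJ i).2 (h ▸ hPQ)
  have hbal := sum_smul_deriv_eq_zero hM hP.1 (fun i => (hw i).le) hγ hPV
    (eventually_mem_nhdsWithin.mono fun X hX => hP.2 X hX)
  simp only [Fin.sum_univ_four, ← hAC, ← hBD, fun i => hφ (V i) (hVJ i) (γ i) (hγ i)] at hbal
  have hne : ∀ i j, i ≠ j → φ (V i) ≠ φ (V j) := fun i j hij h =>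
    hij (hinj (hφi (hVJ i) (hVJ j) h))
  set A : Fin 4 → Set E3 := fun i => arcSet M (V i) (V (i + 1)) (σ i)
  have hAl : ∀ i, V i ∈ A i := fun i => (hσ i).mem_arcSet_left
  have hAr : ∀ i, V (i + 1) ∈ A i := fun i => (hσ i).mem_arcSet_right
  have hadj' : ∀ i x, x ∈ A i → x ∈ A (i + 1) → x = V (i + 1) := fun i x h1 h2 =>
    (hadj i).subset ⟨h1, h2⟩
  have hopp' : ∀ i x, x ∈ A i → x ∉ A (i + 2) := fun i x h1 h2 => disjoint_left.1 (hopp i) h1 h2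
  have hpre : ∀ i, IsPreconnected (φ '' (A i ∪ A (i + 1))) := fun i =>
    ((hσ i).isPreconnected_arcSet.union (V (i + 1)) (hAr i) (hAl (i + 1))
      (hσ (i + 1)).isPreconnected_arcSet).image _
      (hφc.mono (union_subset (hside i) (hside (i + 1))))
  have hsub : ∀ i, A i ∪ A (i + 1) ⊆ J := fun i => union_subset (hside i) (hside (i + 1))
  have hunit : ∀ i, ∀ x ∈ φ '' (A i ∪ A (i + 1)), x ∈ tangentPlane M P ∧ ‖x‖ = 1 := by
    rintro i _ ⟨Y, hY, rfl⟩
    exact hφT Y (hsub i hY)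
  have hVA : ∀ i, V (i + 3) ∉ A i ∪ A (i + 1) := by
    intro i h
    have hl : V (i + 3) ∈ A (i + 3) := hAl (i + 3)
    have hr : V (i + 3) ∈ A (i + 2) := by
      have := hAr (i + 2)
      rwa [add_assoc] at this
    rcases h with h | h
    · exact hopp' i _ h hr
    · refine hopp' (i + 1) _ h ?_
      rwa [add_assoc]
  have hnot : ∀ i, φ (V (i + 3)) ∉ φ '' (A i ∪ A (i + 1)) := fun i h => by
    rw [hφi.mem_image_iff (hsub i) (hVJ _)] at h
    exact hVA i h
  -- By injectivity of `φ` this reduces to the sides themselves: opposite sides are disjoint and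
  -- adjacent ones share only a vertex.
  have hinter : φ '' (A 1 ∪ A 2) ∩ φ '' (A 3 ∪ A 0) ⊆ {φ (V 1), φ (V 3)} := by
    have e1 : A 1 ∪ A 2 ⊆ J := hsub 1
    have e2 : A 3 ∪ A 0 ⊆ J := hsub 3
    rw [← hφi.image_inter e1 e2]
    rintro _ ⟨Y, ⟨h1 | h1, h2 | h2⟩, rfl⟩
    · exact absurd h2 (hopp' 1 _ h1)
    · exact Or.inl (by rw [hadj' 0 Y h2 h1]; rfl)
    · exact Or.inr (by rw [hadj' 2 Y h1 h2]; rfl)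
    · exact absurd h2 (hopp' 2 _ h1)
  have h02 : φ (V 0) + φ (V 2) = 0 := by
    refine add_eq_zero_of_balanced (hM.finrank_tangentPlane hP.1) (hpre 1) (hpre 3)
      (hunit 1) (hunit 3) (mem_image_of_mem _ (Or.inl (hAl 1))) (mem_image_of_mem _ (Or.inr (hAl 2)))
      (mem_image_of_mem _ (Or.inr (hAr 2))) (mem_image_of_mem _ (Or.inr (hAl 0)))
      (mem_image_of_mem _ (Or.inr (hAr 0))) (mem_image_of_mem _ (Or.inl (hAl 3)))
      (hnot 1) (hnot 3) hinter (hne 1 3 (by decide)) (hw 0) (hw 1) ?_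
    rw [← hbal, smul_add, smul_add]; abel
  have h13 : φ (V 1) + φ (V 3) = 0 := by
    have h1 : w 0 • (φ (V 0) + φ (V 2)) + w 1 • (φ (V 1) + φ (V 3)) = 0 := by
      rw [← hbal, smul_add, smul_add]; abel
    rw [h02, smul_zero, zero_add] at h1
    exact (smul_eq_zero.1 h1).resolve_left (hw 1).ne'
  have h3 : φ (V 3) = -φ (V 1) := eq_neg_of_add_eq_zero_right h13
  exact ⟨fun i => φ (V i), fun i => (hφT _ (hVJ i)).2, eq_neg_of_add_eq_zero_right h02, h3,
    hne 0 1 (by decide), h3 ▸ hne 0 3 (by decide), fun i => hφ _ (hVJ i)⟩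

/-! ### The direct transformation and its parallelogram. -/

theorem proposition4p2 (M : Set E3) (hM : IsC2ConvexSurface M)
    (V : Fin 4 → E3) (Q : Set E3) (hQ : IsConvexQuadrilateral M Q V)
    (hQ_disc : ∀ X ∈ Q, ENNReal.ofReal (surfaceDist M (V 0) X) ≤ injectivityRadius M)
    (hQ_perimeter : ENNReal.ofReal (∑ i, surfaceDist M (V i) (V (i + 1))) <
      2 * injectivityRadius M)
    (w : Fin 4 → ℝ) (hw : ∀ i, 0 < w i)
    (P : E3) (hP : IsFermatTorricelli M V w P) (hP_int : P ∈ surfaceInterior M Q)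
    (hAC : w 0 = w 2) (hBD : w 1 = w 3) :
    (∃ R R' : Fin 4 → E3, IsDirectTransform M P V w R R') ∧
    ∀ R R' : Fin 4 → E3, IsDirectTransform M P V w R R' →
      (∀ i, R' i ∈ tangentPlane M P ∧ ‖R' i‖ = w i ∧ ExpEq M P (R' i) (R i) ∧
        (ENNReal.ofReal (w i) < injectivityRadius M → surfaceDist M P (R i) = w i)) ∧
      IsParallelogram (R' 0) (R' 1) (R' 2) (R' 3) ∧
      midpoint ℝ (R' 0) (R' 2) = 0 ∧ midpoint ℝ (R' 1) (R' 3) = 0 := by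
  obtain ⟨⟨K, hK, -, -, rfl⟩, hM2⟩ := hM
  have hc : IsCompact (frontier K) :=
    hK.of_isClosed_subset isClosed_frontier hK.isClosed.frontier_subset
  have hVQ : ∀ i, V i ∈ Q := fun i => by
    obtain ⟨-, -, -, -, σ, hσ, -, -, hbd⟩ := hQ
    have h1 : V i ∈ Q \ surfaceInterior (frontier K) Q := by
      rw [hbd]
      exact mem_iUnion.2 ⟨i, (hσ i).mem_arcSet_left⟩
    exact h1.1
  obtain ⟨u, hu1, hu2, hu3, hu01, hu01', hu⟩ :=
    exists_opposite_directions hM2 hc hQ hQ_perimeter hw hP hP_int hAC hBD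
  refine ⟨?_, fun R R' hR => ?_⟩
  · have hex : ∀ i, ∃ γ, IsShortestGeodesic (frontier K) P (V i) γ := fun i =>
      (hQ.2.2.1 P hP_int.1 _ (hVQ i)).1
    choose γ hγ using hex
    exact ⟨fun i => γ i (w i), fun i => w i • deriv (γ i) 0, fun i => ⟨γ i, hγ i, rfl, rfl⟩⟩
  -- Every shortest arc from `P` to `V i` has direction `u i`, so `R'` does not depend on the choice
  -- of arcs.
  · have hR' : ∀ i, R' i = w i • u i := fun i => by
      obtain ⟨γ, hγ, -, h⟩ := hR i
      rw [h, hu i γ hγ]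
    refine ⟨fun i => ?_, ?_, ?_, ?_⟩
    · obtain ⟨γ, hγ, h1, h2⟩ := hR i
      have h3 := hγ.1.deriv_mem_tangentPlane hM2 0
      have h4 := hγ.1.expEq (w i)
      rw [hγ.2.2.1] at h3 h4
      refine ⟨h2 ▸ Submodule.smul_mem _ _ h3, ?_, h1 ▸ h2 ▸ h4, fun hi => ?_⟩
      · rw [h2, norm_smul, hγ.2.1, mul_one, Real.norm_of_nonneg (hw i).le]
      · have h5 := hγ.1.surfaceDist_apply hγ.2.1 (hw i).le hi
        rwa [hγ.2.2.1, ← h1] at h5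
    · rw [hR', hR', hR', hR', hu2, hu3, ← hAC, ← hBD]
      exact isParallelogram_of_opposite (hu1 0) (hu1 1) hu01 hu01' (hw 0) (hw 1)
    · rw [hR', hR', hu2, ← hAC, smul_neg, midpoint_self_neg]
    · rw [hR', hR', hu3, ← hBD, smul_neg, midpoint_self_neg]
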